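/- **Setting.** Let $\Omega\subset\mathbb R^d$ be compact and convex, $N\ge 1$, $K_x,K_\phi>0$, and let $\bar\rho:\Omega\times[0,\infty)\to[0,\infty)$ be a $C^1$ function, Lipschitz in time (uniformly in space), with $\int_\Omega\bar\rho(x,t)\,dx=1$ for all $t\ge0$; put $d\bar\mu_t=\bar\rho(\cdot,t)\,dx$ on $\Omega$. For $p=(p_1,\dots,p_N)\in(\mathbb R^d)^N$ and $\phi\in\mathbb R^N$ let $$\mathcal V_i=\mathcal V_i(p,\phi)=\{x\in\Omega:\tfrac12\|p_i-x\|^2-\phi_i\le\tfrac12\|p_j-x\|^2-\phi_j\ \ \forall j\},$$ $$a_i=\int_{\mathcal V_i}\bar\rho\,dx,\qquad b_i=\frac1{a_i}\int_{\mathcal V_i}x\,\bar\rho\,dx,\qquad F(p,\phi,t)=\sum_{i=1}^N\Big[\int_{\mathcal V_i}\tfrac12\|p_i-x\|^2\bar\rho\,dx+\big(\tfrac1N-a_i\big)\phi_i\Big],$$ and let $W(p,t)$ be the infimum of $\int\frac12\|x-y\|^2d\pi$ over the couplings $\pi$ of $\frac1N\sum_i\delta_{p_i}$ and $\bar\mu_t$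 (the squared Wasserstein distance). Call $(p,\phi)$ *centroidal with equal masses at time $t$* if $p_i=b_i$ and $a_i=1/N$ for all $i$. **Theorem.** (I) *Saddle points.* Let $t\ge0$ and let $p_1,\dots,p_N$ be distinct. Then: 1. $W(p,t)=\max_{\phi}F(p,\phi,t)<\infty$. 2. For every $\phi$, $F(\cdot,\cdot,t)$ is $C^1$ near $(p,\phi)$, with $\nabla_{p_i}F=a_i(p_i-b_i)$ (read as $a_ip_i-\int_{\mathcal V_i}x\bar\rho\,dx$ if $a_i=0$) and $\partial_{\phi_i}F=\frac1N-a_i$. Hence $(p,\phi)$ is a critical point of $F(\cdot,\cdot,t)$ if and only if it is centroidal with equal masses at time $t$. 3. $F(p,\cdot,t)$ is concave, and $\phi$ maximizes it if and only if $a_i=1/N$ for all $i$. Along every solution on $[0,\infty)$ of the dual law $\phi_i'(s)=K_\phi\big(\frac1N-a_i(p,\phi(s),t)\big)$ with $p$ and $t$ frozen, $a_i\to\frac1N$ for all $i$ and $F(p,\phi(s),t)\to W(p,t)$ as $s\to\infty$. 4. If $p\in\Omega^N$ is a local minimizer of $W(\cdot,t)$ on $\Omega^N$, then $(p,\phi)$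 is centroidal with equal masses for every maximizer $\phi$ of $F(p,\cdot,t)$. Conversely, if $(p,\phi)$ is centroidal with equal masses and the Hessian $\nabla_p^2F(\cdot,\phi,t)$ is positive definite in a neighbourhood of $p$, then $(p,\phi)$ is a local saddle point of $F(\cdot,\cdot,t)$ ($\phi$ is a global maximizer of $F(p,\cdot,t)$, and $p$ is a strict local minimizer of $F(\cdot,\phi,t)$), and $p$ is a strict local minimizer of $W(\cdot,t)$. (II) *Coupled dynamics.* Let $J\subseteq[0,\infty)$ be an interval and let $(p(t),\phi(t))$ be a Carathéodory solution on $J$ (both components absolutely continuous on compact subintervals of $J$, equations satisfied for almost every $t\in J$), with arbitrary initial values, of $$\dot p_i=-K_x(p_i-b_i)+\dot b_i,\qquad \dot\phi_i=K_\phi\big(\tfrac1N-a_i\big),\qquad i=1,\dots,N,$$ where $a_i,b_i$ are evaluated at $(p(t),\phi(t),t)$. Assume that for every $t\in J$ the agents $p_1(t),\dots,p_N(t)$ are distinct and all the cell masses $a_i$ are positive. Then $b$ is absolutely continuous on the compact subintervals of $J$ (so $\dot b$ exists almost everywhere); $\dot\phi_i=K_\phi\,\partial_{\phi_i}F(p(t),\phi(t),t)$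 almost everywhere; and $V=\frac12\|p-b\|^2$ is absolutely continuous on the compact subintervals of $J$, satisfies $\dot V=-2K_xV$ almost everywhere on $J$, and $V(t)=e^{-2K_x(t-s)}V(s)$ for all $s\le t$ in $J$. If $J$ is unbounded, then $p_i(t)-b_i(t)\to0$ and $\nabla_{p_i}F(p(t),\phi(t),t)\to0$ as $t\to\infty$, for every $i$. -/

import Mathlib

open Set Filter Topology MeasureTheory

noncomputable section

namespace SemiDiscreteOT

/-- The Euclidean space `ℝ^d`. -/
abbrev Space (d : ℕ) : Type := EuclideanSpace ℝ (Fin d)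

/-- Positions of `N` agents in `ℝ^d`. -/
abbrev Config (N d : ℕ) : Type := Fin N → Space d

/-- Vectors of dual variables, one for each agent. -/
abbrev Dual (N : ℕ) : Type := Fin N → ℝ

variable {d N : ℕ}

/-- `ρ x t` is a time-varying probability density on `Ω`, for times `t ≥ 0`, which is jointly `C¹` on
`Ω × [0, ∞)` and Lipschitz in time, uniformly in space. -/
structure IsTargetDensity (Ω : Set (Space d)) (ρ : Space d → ℝ → ℝ) : Prop where
  nonneg : ∀ x ∈ Ω, ∀ t, 0 ≤ t → 0 ≤ ρ x t
  mass_one : ∀ t, 0 ≤ t → ∫ x in Ω, ρ x t = 1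
  contDiffOn : ContDiffOn ℝ 1 (fun z : Space d × ℝ => ρ z.1 z.2) (Ω ×ˢ Ici 0)
  lipschitz : ∃ L : ℝ, ∀ x ∈ Ω, ∀ s t, 0 ≤ s → 0 ≤ t → |ρ x s - ρ x t| ≤ L * |s - t|

/-- The absolutely continuous measure on `Ω` with density `ρ (·) t`. -/
def targetMeasure (Ω : Set (Space d)) (ρ : Space d → ℝ → ℝ) (t : ℝ) : Measure (Space d) :=
  (volume.restrict Ω).withDensity (fun x => ENNReal.ofReal (ρ x t))

/-- The empirical measure `(1/N) ∑ δ_{p_i}`. -/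
def empiricalMeasure (p : Config N d) : Measure (Space d) :=
  (N : ENNReal)⁻¹ • ∑ i, Measure.dirac (p i)

/-- The couplings of two measures. -/
def couplings (μ ν : Measure (Space d)) : Set (Measure (Space d × Space d)) :=
  {π | π.map Prod.fst = μ ∧ π.map Prod.snd = ν}

/-- The squared `2`-Wasserstein distance, for the cost `½ ‖x - y‖²`. -/
def wassersteinSq (μ ν : Measure (Space d)) : ENNReal :=
  ⨅ π ∈ couplings μ ν, ∫⁻ z, ENNReal.ofReal ((1 / 2) * ‖z.1 - z.2‖ ^ 2) ∂π

/-- The squared Wasserstein distance between the agents' empirical measure and the target at time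
`t`: the function of the positions which is to be minimized at each time. -/
def transportCost (Ω : Set (Space d)) (ρ : Space d → ℝ → ℝ) (p : Config N d) (t : ℝ) : ENNReal :=
  wassersteinSq (empiricalMeasure p) (targetMeasure Ω ρ t)

/-- The Laguerre cell of agent `i`. The inequality is trivial for `j = i`. -/
def laguerreCell (Ω : Set (Space d)) (p : Config N d) (φ : Dual N) (i : Fin N) : Set (Space d) :=
  {x | x ∈ Ω ∧ ∀ j, (1 / 2) * ‖p i - x‖ ^ 2 - φ i ≤ (1 / 2) * ‖p j - x‖ ^ 2 - φ j}

/-- The mass `a_i` of the Laguerre cell of agent `i` at time `t`. -/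
def cellMass (Ω : Set (Space d)) (ρ : Space d → ℝ → ℝ) (p : Config N d) (φ : Dual N) (t : ℝ)
    (i : Fin N) : ℝ :=
  ∫ x in laguerreCell Ω p φ i, ρ x t

/-- The barycenter `b_i` of the Laguerre cell of agent `i` at time `t`
(meaningful when the cell has positive mass). -/
def barycenter (Ω : Set (Space d)) (ρ : Space d → ℝ → ℝ) (p : Config N d) (φ : Dual N) (t : ℝ)
    (i : Fin N) : Space d :=
  (cellMass Ω ρ p φ t i)⁻¹ • ∫ x in laguerreCell Ω p φ i, ρ x t • x

/-- The objective `F(p, φ, t)` of the min–max problem `min_p max_φ F(p, φ, t)`. -/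
def dualObjective (Ω : Set (Space d)) (ρ : Space d → ℝ → ℝ) (p : Config N d) (φ : Dual N)
    (t : ℝ) : ℝ :=
  ∑ i, ((∫ x in laguerreCell Ω p φ i, (1 / 2) * ‖p i - x‖ ^ 2 * ρ x t)
    + (1 / (N : ℝ) - ∫ x in laguerreCell Ω p φ i, ρ x t) * φ i)

/-- Every agent is at the barycenter of its cell and all the cells have mass `1/N`. -/
def IsCentroidalEqualMass (Ω : Set (Space d)) (ρ : Space d → ℝ → ℝ) (p : Config N d)
    (φ : Dual N) (t : ℝ) : Prop :=
  ∀ i, p i = barycenter Ω ρ p φ t i ∧ cellMass Ω ρ p φ t i = 1 / (N : ℝ)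

/-- `(p, φ)` is a Carathéodory solution, on the time interval `J`, of
`ṗ_i = - Kx (p_i - b_i) + ḃ_i`, `φ̇_i = Kφ (1/N - a_i)`: both components are absolutely continuous
on the compact subintervals of `J` and satisfy the equations at almost every time of `J`.
Here `ḃ_i` is the time derivative of the barycenter along the trajectory; its existence almost
everywhere is not demanded here. -/
structure IsCaratheodorySolution (Ω : Set (Space d)) (ρ : Space d → ℝ → ℝ) (Kx Kφ : ℝ)
    (J : Set ℝ) (p : ℝ → Config N d) (φ : ℝ → Dual N) : Prop where
  ac_primal : ∀ s ∈ J, ∀ t ∈ J, AbsolutelyContinuousOnInterval p s t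
  ac_dual : ∀ s ∈ J, ∀ t ∈ J, AbsolutelyContinuousOnInterval φ s t
  primal : ∀ᵐ t : ℝ, t ∈ J → ∀ i,
    HasDerivAt (fun s => p s i)
      (-(Kx • (p t i - barycenter Ω ρ (p t) (φ t) t i))
        + deriv (fun s => barycenter Ω ρ (p s) (φ s) s i) t) t
  dual : ∀ᵐ t : ℝ, t ∈ J → ∀ i,
    HasDerivAt (fun s => φ s i) (Kφ * (1 / (N : ℝ) - cellMass Ω ρ (p t) (φ t) t i)) t

/-- The tracking error `V(t) = ½ ‖p(t) - b(t)‖²`, with the Euclidean norm of `(ℝ^d)^N`. -/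
def trackingError (Ω : Set (Space d)) (ρ : Space d → ℝ → ℝ) (p : ℝ → Config N d) (φ : ℝ → Dual N)
    (t : ℝ) : ℝ :=
  (1 / 2) * ∑ i, ‖p t i - barycenter Ω ρ (p t) (φ t) t i‖ ^ 2

end SemiDiscreteOT

end

open SemiDiscreteOT

/-! Two power costs differ by an affine function of `x`, because the term `‖x‖²` cancels. If the
agents are distinct, ties lie on finitely many hyperplanes, which the target measure does not
charge. Hence `F` is the Kantorovich functional, the integral of the pointwise minimum of the power
costs plus the mean of `φ` (`IsHyperplaneNull.kantorovich_eq`). Off the ties the minimizing agent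
does not change under small perturbations of `(p, φ)`, so differentiation under the integral gives
the gradients, and dominated convergence their continuity (`hasFDerivAt_kantorovich`,
`contDiffAt_kantorovich`).

In `φ`, the vector `1/N - a_i` is a supergradient (`kantorovich_le_add`). Concavity follows, and a
maximizer is the same as a vector with equal masses. One exists because the functional is invariant
under adding constants to `φ` and, after normalization, small outside a box. Every value of `F` is a
lower bound for the transport cost, and sending equal-mass cells to their agents attains it.

Two comparisons settle the local minimizers. Keeping equal-mass cells while an agent moves bounds
the cost from above, so an agent off its barycenter could be improved. Keeping `φ` while the agents
move bounds the cost from below by `F(q, φ)`, so a strict minimum of `F(·, φ)` passes to the cost.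
The frozen dual law is gradient ascent of a concave function: the squared distance to a maximizer
plus a multiple of `s` times the optimality gap decreases, so the gap is `O(1/s)` on a bounded
trajectory, and compactness turns this into convergence of the masses.

For the coupled dynamics, the volume of a slab is at most linear in its width
(`volume_real_slab_le`), so cells of separated agents move in a Lipschitz way. Masses and
barycenters are therefore absolutely continuous along the trajectory. The term `ḃ` then cancels in
the equation for `p - b`, which becomes linear, and an integrating factor gives the exact decay. -/

noncomputable section

namespace SemiDiscreteOT

variable {d N : ℕ}

/-! ### Power costs and Laguerre cells. -/

/-- The power cost `½ ‖p_i - x‖² - φ_i` of agent `i`, where `z = (p, φ)`. -/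
def powerCost (z : Config N d × Dual N) (i : Fin N) (x : Space d) : ℝ :=
  (1 / 2) * ‖z.1 i - x‖ ^ 2 - z.2 i

/-- The smallest power cost at `x`. -/
def minCost [Nonempty (Fin N)] (z : Config N d × Dual N) (x : Space d) : ℝ :=
  Finset.univ.inf' Finset.univ_nonempty fun i => powerCost z i x

/-- The constant term of the affine function which separates the cells of `i` and `j`. -/
def separatingLevel (z : Config N d × Dual N) (i j : Fin N) : ℝ :=
  ((1 / 2) * ‖z.1 i‖ ^ 2 - z.2 i) - ((1 / 2) * ‖z.1 j‖ ^ 2 - z.2 j)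

/-- The cancellation of `‖x‖²` makes the boundary between two cells a piece of a hyperplane with
normal `p_i - p_j`. The null ties and the slab estimates both rest on this. -/
theorem powerCost_sub_powerCost (z : Config N d × Dual N) (i j : Fin N) (x : Space d) :
    powerCost z i x - powerCost z j x
      = separatingLevel z i j - inner ℝ (z.1 i - z.1 j) x := by
  simp only [powerCost, separatingLevel, @norm_sub_sq_real, inner_sub_left]
  ring

theorem continuous_powerCost_right (z : Config N d × Dual N) (i : Fin N) :
    Continuous fun x => powerCost z i x := by
  unfold powerCost; fun_prop

theorem continuous_powerCost_left (i : Fin N) (x : Space d) :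
    Continuous fun z : Config N d × Dual N => powerCost z i x := by
  unfold powerCost; fun_prop

/-- Factor the difference of squares: the difference of the two norms is at most `‖z - w‖` and their
sum at most `4R`. The constant does not depend on `x`, so it serves both as a dominating function
and as a slab width. -/
theorem abs_powerCost_sub_le {z w : Config N d × Dual N} {x : Space d} {R : ℝ}
    (hz : ‖z‖ ≤ R) (hw : ‖w‖ ≤ R) (hx : ‖x‖ ≤ R) (i : Fin N) :
    |powerCost z i x - powerCost w i x| ≤ (2 * R + 1) * ‖z - w‖ := by
  have h1 : ‖z.1 i - w.1 i‖ ≤ ‖z - w‖ :=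
    (norm_le_pi_norm (z.1 - w.1) i).trans (norm_fst_le (z - w))
  have h2 : |z.2 i - w.2 i| ≤ ‖z - w‖ :=
    (norm_le_pi_norm (z.2 - w.2) i).trans (norm_snd_le (z - w))
  have h3 : ‖z.1 i‖ ≤ R := ((norm_le_pi_norm z.1 i).trans (norm_fst_le z)).trans hz
  have h4 : ‖w.1 i‖ ≤ R := ((norm_le_pi_norm w.1 i).trans (norm_fst_le w)).trans hw
  have h5 : |‖z.1 i - x‖ - ‖w.1 i - x‖| ≤ ‖z.1 i - w.1 i‖ := by
    simpa using abs_norm_sub_norm_le (z.1 i - x) (w.1 i - x)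
  have h6 : ‖z.1 i - x‖ ≤ 2 * R := (norm_sub_le _ _).trans (by linarith)
  have h7 : ‖w.1 i - x‖ ≤ 2 * R := (norm_sub_le _ _).trans (by linarith)
  have h8 : |(‖z.1 i - x‖ - ‖w.1 i - x‖) * (‖z.1 i - x‖ + ‖w.1 i - x‖)|
      ≤ ‖z - w‖ * (4 * R) := by
    rw [abs_mul]
    refine mul_le_mul (h5.trans h1) ?_ (abs_nonneg _) (norm_nonneg _)
    rw [abs_of_nonneg (by positivity)]
    linarith
  have h9 : powerCost z i x - powerCost w i x
      = (1 / 2) * ((‖z.1 i - x‖ - ‖w.1 i - x‖) * (‖z.1 i - x‖ + ‖w.1 i - x‖))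
        - (z.2 i - w.2 i) := by
    simp only [powerCost]; ring
  rw [h9, abs_le]
  rw [abs_le] at h8 h2
  constructor <;> linarith [h8.1, h8.2, h2.1, h2.2]

section Cells

variable {Ω : Set (Space d)}

theorem laguerreCell_subset (p : Config N d) (φ : Dual N) (i : Fin N) :
    laguerreCell Ω p φ i ⊆ Ω := fun _ hx => hx.1

theorem isClosed_laguerreCell (hΩ : IsClosed Ω) (p : Config N d) (φ : Dual N) (i : Fin N) :
    IsClosed (laguerreCell Ω p φ i) := by
  have : laguerreCell Ω p φ i
      = Ω ∩ ⋂ j, {x | powerCost (p, φ) i x ≤ powerCost (p, φ) j x} := by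
    ext x; simp [laguerreCell, powerCost]
  rw [this]
  exact hΩ.inter (isClosed_iInter fun j => isClosed_le
    (continuous_powerCost_right _ _) (continuous_powerCost_right _ _))

theorem measurableSet_laguerreCell (hΩ : IsCompact Ω) (p : Config N d) (φ : Dual N) (i : Fin N) :
    MeasurableSet (laguerreCell Ω p φ i) :=
  (isClosed_laguerreCell hΩ.isClosed p φ i).measurableSet

variable [Nonempty (Fin N)]

theorem minCost_le (z : Config N d × Dual N) (i : Fin N) (x : Space d) :
    minCost z x ≤ powerCost z i x :=
  Finset.inf'_le _ (Finset.mem_univ i)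

theorem le_minCost_iff {z : Config N d × Dual N} {x : Space d} {c : ℝ} :
    c ≤ minCost z x ↔ ∀ i, c ≤ powerCost z i x := by
  simp [minCost]

theorem exists_minCost_eq (z : Config N d × Dual N) (x : Space d) :
    ∃ i, minCost z x = powerCost z i x := by
  obtain ⟨i, -, hi⟩ := Finset.exists_mem_eq_inf' (s := Finset.univ) Finset.univ_nonempty
    fun i => powerCost z i x
  exact ⟨i, hi⟩

theorem minCost_eq_of_forall_le {z : Config N d × Dual N} {i : Fin N} {x : Space d}
    (h : ∀ j, powerCost z i x ≤ powerCost z j x) : minCost z x = powerCost z i x :=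
  le_antisymm (minCost_le z i x) (le_minCost_iff.2 h)

theorem continuous_minCost (z : Config N d × Dual N) : Continuous (minCost z) := by
  unfold minCost
  exact Continuous.finset_inf'_apply _ fun i _ => continuous_powerCost_right z i

theorem minCost_le_minCost_add {z w : Config N d × Dual N} {x : Space d} {c : ℝ}
    (h : ∀ i, |powerCost z i x - powerCost w i x| ≤ c) : minCost z x ≤ minCost w x + c := by
  obtain ⟨i, hi⟩ := exists_minCost_eq w x
  linarith [minCost_le z i x, (abs_le.1 (h i)).2]

theorem abs_minCost_sub_le {z w : Config N d × Dual N} {x : Space d} {c : ℝ}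
    (h : ∀ i, |powerCost z i x - powerCost w i x| ≤ c) : |minCost z x - minCost w x| ≤ c := by
  have h1 := minCost_le_minCost_add h
  have h2 := minCost_le_minCost_add fun i => (abs_sub_comm _ _).trans_le (h i)
  rw [abs_le]; constructor <;> linarith

theorem laguerreCell_iUnion (z : Config N d × Dual N) :
    ⋃ i, laguerreCell Ω z.1 z.2 i = Ω := by
  ext x
  simp only [mem_iUnion]
  refine ⟨fun ⟨i, hi⟩ => hi.1, fun hx => ?_⟩
  obtain ⟨i, hi⟩ := exists_minCost_eq z x
  refine ⟨i, hx, fun j => ?_⟩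
  have h := minCost_le z j x
  rwa [hi] at h

end Cells

/-! ### Measures that do not charge hyperplanes. -/

/-- A probability measure concentrated on the compact set `Ω` which does not charge
hyperplanes. -/
structure IsHyperplaneNull (Ω : Set (Space d)) (ν : Measure (Space d)) : Prop where
  isProbabilityMeasure : IsProbabilityMeasure ν
  isCompact : IsCompact Ω
  measure_compl : ν Ωᶜ = 0
  measure_hyperplane : ∀ (u : Space d) (c : ℝ), u ≠ 0 → ν {x | inner ℝ u x = c} = 0

namespace IsHyperplaneNull

variable {Ω : Set (Space d)} {ν : Measure (Space d)} (hν : IsHyperplaneNull Ω ν)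
include hν

theorem ae_mem : ∀ᵐ x ∂ν, x ∈ Ω := by
  rw [ae_iff]; exact hν.measure_compl

theorem exists_norm_le : ∃ R : ℝ, 0 ≤ R ∧ ∀ x ∈ Ω, ‖x‖ ≤ R := by
  obtain ⟨R, hR⟩ := hν.isCompact.isBounded.exists_norm_le
  exact ⟨max R 0, le_max_right _ _, fun x hx => (hR x hx).trans (le_max_left _ _)⟩

theorem integrable_of_continuous {F : Type*} [NormedAddCommGroup F]
    {f : Space d → F} (hf : Continuous f) : Integrable f ν := by
  have := hν.isProbabilityMeasure
  have h1 : ν.restrict Ω = ν := Measure.restrict_eq_self_of_ae_mem hν.ae_mem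
  have h2 : IntegrableOn f Ω ν := hf.continuousOn.integrableOn_compact hν.isCompact
  rwa [IntegrableOn, h1] at h2

/-- A tie between two agents lies on a hyperplane whose normal is nonzero because the agents are
distinct; there are finitely many pairs. -/
theorem ae_exists_strict_min [Nonempty (Fin N)] {z : Config N d × Dual N}
    (hz : Function.Injective z.1) :
    ∀ᵐ x ∂ν, x ∈ Ω ∧ ∃ i, ∀ j, j ≠ i → powerCost z i x < powerCost z j x := by
  have h : ∀ᵐ x ∂ν, ∀ i j, i ≠ j → powerCost z i x ≠ powerCost z j x := by
    refine ae_all_iff.2 fun i => ae_all_iff.2 fun j => ?_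
    by_cases hij : i = j
    · simp [hij]
    have h0 := hν.measure_hyperplane (z.1 i - z.1 j) (separatingLevel z i j)
      (sub_ne_zero.2 (hz.ne hij))
    have h1 : ∀ᵐ x ∂ν, inner ℝ (z.1 i - z.1 j) x ≠ separatingLevel z i j := by
      rw [ae_iff]; simpa using h0
    filter_upwards [h1] with x hx _ he
    apply hx
    linarith [powerCost_sub_powerCost z i j x]
  filter_upwards [h, hν.ae_mem] with x hx hxΩ
  obtain ⟨i, hi⟩ := exists_minCost_eq z x
  exact ⟨hxΩ, i, fun j hj => lt_of_le_of_ne (hi ▸ minCost_le z j x) (hx i j hj.symm)⟩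

/-- The closed cells overlap only at ties, so almost every point is in exactly one of them. -/
theorem integral_eq_sum_setIntegral [Nonempty (Fin N)] {F : Type*} [NormedAddCommGroup F]
    [NormedSpace ℝ F] {z : Config N d × Dual N} (hz : Function.Injective z.1)
    {f : Space d → F} {g : Fin N → Space d → F} (hg : ∀ i, Continuous (g i))
    (hfg : ∀ i, ∀ x ∈ laguerreCell Ω z.1 z.2 i, f x = g i x) :
    ∫ x, f x ∂ν = ∑ i, ∫ x in laguerreCell Ω z.1 z.2 i, g i x ∂ν := by
  simp_rw [← integral_indicator (measurableSet_laguerreCell hν.isCompact z.1 z.2 _)]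
  rw [← integral_finsetSum]
  · refine integral_congr_ae ?_
    filter_upwards [hν.ae_exists_strict_min hz] with x ⟨hxΩ, i, hi⟩
    have hxi : x ∈ laguerreCell Ω z.1 z.2 i := by
      refine ⟨hxΩ, fun j => ?_⟩
      by_cases hj : j = i
      · rw [hj]
      · exact (hi j hj).le
    rw [Finset.sum_eq_single i, indicator_of_mem hxi, hfg i x hxi]
    · intro j _ hj
      exact indicator_of_notMem (fun hxj => absurd (hxj.2 i) (not_le.2 (hi j hj))) _
    · simp
  · intro i _
    exact (hν.integrable_of_continuous (hg i)).indicator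
      (measurableSet_laguerreCell hν.isCompact z.1 z.2 i)

end IsHyperplaneNull

/-! ### The Kantorovich functional and its derivative. -/

/-- The Kantorovich functional `∫ min_i (½ ‖p_i - x‖² - φ_i) dν + (1/N) ∑ φ_i`. -/
def kantorovich [Nonempty (Fin N)] (ν : Measure (Space d)) (z : Config N d × Dual N) : ℝ :=
  ∫ x, minCost z x ∂ν + (1 / (N : ℝ)) * ∑ i, z.2 i

theorem IsHyperplaneNull.kantorovich_eq [Nonempty (Fin N)] {Ω : Set (Space d)}
    {ν : Measure (Space d)} (hν : IsHyperplaneNull Ω ν) {z : Config N d × Dual N}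
    (hz : Function.Injective z.1) :
    kantorovich ν z = ∑ i, ((∫ x in laguerreCell Ω z.1 z.2 i, (1 / 2) * ‖z.1 i - x‖ ^ 2 ∂ν)
      + (1 / (N : ℝ) - ν.real (laguerreCell Ω z.1 z.2 i)) * z.2 i) := by
  have := hν.isProbabilityMeasure
  rw [kantorovich, hν.integral_eq_sum_setIntegral hz (continuous_powerCost_right z)
    fun i x hx => minCost_eq_of_forall_le hx.2, Finset.mul_sum, ← Finset.sum_add_distrib]
  refine Finset.sum_congr rfl fun i _ => ?_
  unfold powerCost
  rw [integral_sub]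
  · simp; ring
  · exact (hν.integrable_of_continuous (by fun_prop)).integrableOn
  · exact integrable_const _

/-- The derivative in `z = (p, φ)` of the power cost of agent `i` at `x`. -/
def powerCostDeriv (z : Config N d × Dual N) (i : Fin N) (x : Space d) :
    Config N d × Dual N →L[ℝ] ℝ :=
  (innerSL ℝ (z.1 i - x)).comp ((ContinuousLinearMap.proj i).comp
    (ContinuousLinearMap.fst ℝ (Config N d) (Dual N)))
  - (ContinuousLinearMap.proj i).comp (ContinuousLinearMap.snd ℝ (Config N d) (Dual N))

@[simp]
theorem powerCostDeriv_apply (z v : Config N d × Dual N) (i : Fin N) (x : Space d) :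
    powerCostDeriv z i x v = inner ℝ (z.1 i - x) (v.1 i) - v.2 i := rfl

theorem continuous_powerCostDeriv (z : Config N d × Dual N) (i : Fin N) :
    Continuous fun x => powerCostDeriv z i x := by
  unfold powerCostDeriv
  fun_prop

theorem hasFDerivAt_powerCost (z : Config N d × Dual N) (i : Fin N) (x : Space d) :
    HasFDerivAt (fun w => powerCost w i x) (powerCostDeriv z i x) z := by
  have h1 : HasFDerivAt (fun w : Config N d × Dual N => w.1 i - x)
      ((ContinuousLinearMap.proj i).comp (ContinuousLinearMap.fst ℝ (Config N d) (Dual N))) z :=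
    (ContinuousLinearMap.hasFDerivAt ((ContinuousLinearMap.proj i).comp
      (ContinuousLinearMap.fst ℝ (Config N d) (Dual N)))).sub_const x
  have h2 : HasFDerivAt (fun w : Config N d × Dual N => w.2 i)
      ((ContinuousLinearMap.proj i).comp (ContinuousLinearMap.snd ℝ (Config N d) (Dual N))) z :=
    ContinuousLinearMap.hasFDerivAt ((ContinuousLinearMap.proj i).comp
      (ContinuousLinearMap.snd ℝ (Config N d) (Dual N)))
  refine ((h1.norm_sq.const_mul (1 / 2)).sub h2).congr_fderiv ?_
  ext v <;> simp [inner_sub_left]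

theorem eventually_injective {z : Config N d × Dual N} (hz : Function.Injective z.1) :
    ∀ᶠ w in 𝓝 z, Function.Injective w.1 := by
  have h : ∀ᶠ w in 𝓝 z, ∀ i j, i ≠ j → w.1 i ≠ w.1 j := by
    refine eventually_all.2 fun i => eventually_all.2 fun j => ?_
    by_cases hij : i = j
    · simp [hij]
    have hc : ContinuousAt (fun w : Config N d × Dual N => w.1 i - w.1 j) z := by fun_prop
    filter_upwards [hc.eventually_ne (sub_ne_zero.2 (hz.ne hij))] with w hw _
    exact sub_ne_zero.1 hw
  filter_upwards [h] with w hw i j hij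
  by_contra hne
  exact hw i j hne hij

/-- Finitely many strict inequalities between continuous functions persist: the winning agent at a
fixed `x` is locally constant in `(p, φ)`. -/
theorem eventually_strict_min {z : Config N d × Dual N} {x : Space d} {i : Fin N}
    (h : ∀ j, j ≠ i → powerCost z i x < powerCost z j x) :
    ∀ᶠ w in 𝓝 z, ∀ j, j ≠ i → powerCost w i x < powerCost w j x := by
  refine eventually_all.2 fun j => ?_
  by_cases hj : j = i
  · simp [hj]
  · filter_upwards [(continuous_powerCost_left i x).continuousAt.eventually_lt
      (continuous_powerCost_left j x).continuousAt (h j hj)] with w hw _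
    exact hw

theorem mem_laguerreCell_of_strict_min {Ω : Set (Space d)} {z : Config N d × Dual N}
    {x : Space d} {i : Fin N} (hx : x ∈ Ω)
    (h : ∀ j, j ≠ i → powerCost z i x < powerCost z j x) : x ∈ laguerreCell Ω z.1 z.2 i := by
  refine ⟨hx, fun j => ?_⟩
  by_cases hj : j = i
  · rw [hj]
  · exact (h j hj).le

theorem notMem_laguerreCell_of_strict_min {Ω : Set (Space d)} {z : Config N d × Dual N}
    {x : Space d} {i j : Fin N} (hj : j ≠ i)
    (h : ∀ j, j ≠ i → powerCost z i x < powerCost z j x) : x ∉ laguerreCell Ω z.1 z.2 j :=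
  fun hx => absurd (hx.2 i) (not_le.2 (h j hj))

variable {Ω : Set (Space d)} {ν : Measure (Space d)}

/-- The derivative of the Kantorovich functional. -/
def kantorovichDeriv (Ω : Set (Space d)) (ν : Measure (Space d)) (z : Config N d × Dual N) :
    Config N d × Dual N →L[ℝ] ℝ :=
  ∑ i, ((innerSL ℝ (ν.real (laguerreCell Ω z.1 z.2 i) • z.1 i
      - ∫ x in laguerreCell Ω z.1 z.2 i, x ∂ν)).comp ((ContinuousLinearMap.proj i).comp
        (ContinuousLinearMap.fst ℝ (Config N d) (Dual N)))
    + (1 / (N : ℝ) - ν.real (laguerreCell Ω z.1 z.2 i)) •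
      (ContinuousLinearMap.proj i).comp (ContinuousLinearMap.snd ℝ (Config N d) (Dual N)))

theorem kantorovichDeriv_apply (z v : Config N d × Dual N) :
    kantorovichDeriv Ω ν z v = ∑ i, (inner ℝ (ν.real (laguerreCell Ω z.1 z.2 i) • z.1 i
      - ∫ x in laguerreCell Ω z.1 z.2 i, x ∂ν) (v.1 i)
      + (1 / (N : ℝ) - ν.real (laguerreCell Ω z.1 z.2 i)) * v.2 i) := by
  simp [kantorovichDeriv, inner_sub_left, real_inner_smul_left]

namespace IsHyperplaneNull

variable [Nonempty (Fin N)] (hν : IsHyperplaneNull Ω ν)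
include hν

/-- An envelope argument: at almost every `x` the minimum coincides, near `z`, with the power cost
of a single agent, so only the integrand is differentiated and the moving cell boundaries contribute
nothing. -/
theorem hasFDerivAt_kantorovich {z : Config N d × Dual N} (hz : Function.Injective z.1) :
    HasFDerivAt (kantorovich ν) (kantorovichDeriv Ω ν z) z := by
  have := hν.isProbabilityMeasure
  obtain ⟨R, hR0, hR⟩ := hν.exists_norm_le
  -- A common bound for the points of `Ω` and for all parameters in the unit ball around `z`; it
  -- makes `2 * S + 1` a uniform Lipschitz constant.
  set S := R + ‖z‖ + 1 with hS
  have hz0 := norm_nonneg z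
  set D : Space d → (Config N d × Dual N →L[ℝ] ℝ) := fun x =>
    ∑ i, (laguerreCell Ω z.1 z.2 i).indicator (fun x => powerCostDeriv z i x) x with hD
  have hint : ∀ i, Integrable
      ((laguerreCell Ω z.1 z.2 i).indicator (fun x => powerCostDeriv z i x)) ν := fun i =>
    (hν.integrable_of_continuous (continuous_powerCostDeriv z i)).indicator
      (measurableSet_laguerreCell hν.isCompact z.1 z.2 i)
  have key := hasFDerivAt_integral_of_dominated_loc_of_lip' (μ := ν) (𝕜 := ℝ)
    (F := fun w x => minCost w x) (F' := D) (x₀ := z) (s := Metric.ball z 1)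
    (bound := fun _ => 2 * S + 1)
    (Metric.ball_mem_nhds z one_pos)
    (fun w _ => (continuous_minCost w).aestronglyMeasurable)
    (hν.integrable_of_continuous (continuous_minCost z))
    (by
      refine AEStronglyMeasurable.congr
        (f := ∑ i, (laguerreCell Ω z.1 z.2 i).indicator (fun x => powerCostDeriv z i x)) ?_ ?_
      · exact Finset.aestronglyMeasurable_sum _ fun i _ => (hint i).aestronglyMeasurable
      · exact ae_of_all _ fun x => by simp [hD])
    (by
      filter_upwards [hν.ae_mem] with x hx w hw
      rw [mem_ball_iff_norm] at hw
      have hw' : ‖w‖ ≤ ‖z‖ + 1 := by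
        have := norm_le_norm_add_norm_sub' w z
        linarith
      exact abs_minCost_sub_le fun i => abs_powerCost_sub_le (by linarith) (by linarith)
        (by linarith [hR x hx]) i)
    (integrable_const _)
    (by
      filter_upwards [hν.ae_exists_strict_min hz] with x ⟨hxΩ, i, hi⟩
      have hDx : D x = powerCostDeriv z i x := by
        simp only [hD]
        rw [Finset.sum_eq_single i, indicator_of_mem (mem_laguerreCell_of_strict_min hxΩ hi)]
        · exact fun j _ hj => indicator_of_notMem (notMem_laguerreCell_of_strict_min hj hi) _
        · simp
      rw [hDx]
      refine (hasFDerivAt_powerCost z i x).congr_of_eventuallyEq ?_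
      filter_upwards [eventually_strict_min hi] with w hw
      exact minCost_eq_of_forall_le fun j => by
        by_cases hj : j = i
        · rw [hj]
        · exact (hw j hj).le)
  have hlin : HasFDerivAt (fun w : Config N d × Dual N => (1 / (N : ℝ)) * ∑ i, w.2 i)
      ((1 / (N : ℝ)) • ∑ i, (ContinuousLinearMap.proj i).comp
        (ContinuousLinearMap.snd ℝ (Config N d) (Dual N))) z := by
    refine HasFDerivAt.const_mul ?_ _
    refine HasFDerivAt.fun_sum fun i _ => ?_
    exact ContinuousLinearMap.hasFDerivAt ((ContinuousLinearMap.proj i).comp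
      (ContinuousLinearMap.snd ℝ (Config N d) (Dual N)))
  refine (key.2.add hlin).congr_fderiv (ContinuousLinearMap.ext fun v => ?_)
  rw [add_apply, ContinuousLinearMap.integral_apply key.1,
    kantorovichDeriv_apply]
  have h1 : ∫ x, D x v ∂ν = ∑ i, (inner ℝ (ν.real (laguerreCell Ω z.1 z.2 i) • z.1 i
      - ∫ x in laguerreCell Ω z.1 z.2 i, x ∂ν) (v.1 i)
      - ν.real (laguerreCell Ω z.1 z.2 i) * v.2 i) := by
    rw [← ContinuousLinearMap.integral_apply key.1]
    simp only [hD]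
    rw [integral_finsetSum _ fun i _ => hint i, sum_apply]
    refine Finset.sum_congr rfl fun i _ => ?_
    have hcell := measurableSet_laguerreCell hν.isCompact z.1 z.2 i
    rw [integral_indicator hcell, ContinuousLinearMap.integral_apply
      (hν.integrable_of_continuous (continuous_powerCostDeriv z i)).integrableOn]
    have hid : Integrable (fun x : Space d => x) (ν.restrict (laguerreCell Ω z.1 z.2 i)) :=
      (hν.integrable_of_continuous continuous_id).integrableOn
    simp_rw [powerCostDeriv_apply, inner_sub_left, real_inner_smul_left]
    have h3 : Integrable (fun x : Space d => inner ℝ x (v.1 i))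
        (ν.restrict (laguerreCell Ω z.1 z.2 i)) :=
      (hν.integrable_of_continuous (by fun_prop)).integrableOn
    rw [integral_sub (by exact (integrable_const _).sub h3) (integrable_const _),
      integral_sub (integrable_const _) h3]
    simp_rw [real_inner_comm (v.1 i)]
    rw [integral_inner hid]
    simp
  rw [h1]
  simp only [smul_apply, sum_apply]
  simp only [smul_eq_mul, Finset.mul_sum]
  rw [← Finset.sum_add_distrib]
  refine Finset.sum_congr rfl fun i _ => ?_
  simp only [ContinuousLinearMap.comp_apply, ContinuousLinearMap.coe_snd',
    ContinuousLinearMap.proj_apply]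
  ring

/-- The indicator of a cell is locally constant in the parameters at almost every point, and `‖f‖`
dominates. -/
theorem continuousAt_setIntegral_laguerreCell {F : Type*} [NormedAddCommGroup F]
    [NormedSpace ℝ F] {f : Space d → F} (hf : Continuous f) {z : Config N d × Dual N}
    (hz : Function.Injective z.1) (i : Fin N) :
    ContinuousAt (fun w : Config N d × Dual N => ∫ x in laguerreCell Ω w.1 w.2 i, f x ∂ν) z := by
  simp_rw [← integral_indicator (measurableSet_laguerreCell hν.isCompact _ _ i)]
  have hfi := hν.integrable_of_continuous hf
  refine continuousAt_of_dominated (bound := fun x => ‖f x‖) ?_ ?_ hfi.norm ?_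
  · exact Eventually.of_forall fun w => (hfi.indicator
      (measurableSet_laguerreCell hν.isCompact w.1 w.2 i)).aestronglyMeasurable
  · exact Eventually.of_forall fun w => ae_of_all _ fun x => norm_indicator_le_norm_self _ _
  · filter_upwards [hν.ae_exists_strict_min hz] with x ⟨hxΩ, k, hk⟩
    by_cases hki : i = k
    · subst hki
      refine (continuousAt_const (y := f x)).congr ?_
      filter_upwards [eventually_strict_min hk] with w hw
      rw [indicator_of_mem (mem_laguerreCell_of_strict_min hxΩ hw)]
    · refine (continuousAt_const (y := 0)).congr ?_
      filter_upwards [eventually_strict_min hk] with w hw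
      rw [indicator_of_notMem (notMem_laguerreCell_of_strict_min hki hw)]

theorem continuousAt_measureReal_laguerreCell {z : Config N d × Dual N}
    (hz : Function.Injective z.1) (i : Fin N) :
    ContinuousAt (fun w : Config N d × Dual N => ν.real (laguerreCell Ω w.1 w.2 i)) z := by
  have := hν.isProbabilityMeasure
  simpa using hν.continuousAt_setIntegral_laguerreCell (continuous_const (y := (1 : ℝ))) hz i

theorem continuousAt_kantorovichDeriv {z : Config N d × Dual N}
    (hz : Function.Injective z.1) :
    ContinuousAt (kantorovichDeriv (N := N) Ω ν) z := by
  unfold kantorovichDeriv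
  refine tendsto_finsetSum _ fun i _ => ?_
  have h1 := hν.continuousAt_measureReal_laguerreCell hz i
  have h2 := hν.continuousAt_setIntegral_laguerreCell continuous_id hz i
  have h3 : ContinuousAt (fun w : Config N d × Dual N =>
      ν.real (laguerreCell Ω w.1 w.2 i) • w.1 i - ∫ x in laguerreCell Ω w.1 w.2 i, x ∂ν) z :=
    (h1.smul (by fun_prop)).sub h2
  exact (((innerSL ℝ).continuous.continuousAt.comp h3).clm_comp continuousAt_const).add
    ((continuousAt_const.sub h1).smul continuousAt_const)

theorem contDiffAt_kantorovich {z : Config N d × Dual N} (hz : Function.Injective z.1) :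
    ContDiffAt ℝ 1 (kantorovich (N := N) ν) z := by
  rw [contDiffAt_one_iff]
  exact ⟨kantorovichDeriv Ω ν, _, eventually_injective hz,
    fun w hw => (hν.continuousAt_kantorovichDeriv hw).continuousWithinAt,
    fun w hw => hν.hasFDerivAt_kantorovich hw⟩

end IsHyperplaneNull

/-! ### Transport plans and duality. -/

theorem integral_empiricalMeasure {p : Config N d} {f : Space d → ℝ} :
    ∫ x, f x ∂(empiricalMeasure p) = (1 / (N : ℝ)) * ∑ i, f (p i) := by
  rw [empiricalMeasure, integral_smul_measure, integral_finsetSum_measure]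
  · simp
  · exact fun i _ => integrable_dirac (by simp)

theorem isProbabilityMeasure_empiricalMeasure [Nonempty (Fin N)] (p : Config N d) :
    IsProbabilityMeasure (empiricalMeasure p) := by
  have hN : (N : ENNReal) ≠ 0 := by
    have := Fin.pos_iff_nonempty.2 ‹Nonempty (Fin N)›
    exact_mod_cast this.ne'
  refine ⟨?_⟩
  simp [empiricalMeasure, ENNReal.inv_mul_cancel hN]

theorem wassersteinSq_le {μ ν : Measure (Space d)} {π : Measure (Space d × Space d)}
    (hπ : π ∈ couplings μ ν) :
    wassersteinSq μ ν ≤ ∫⁻ z, ENNReal.ofReal ((1 / 2) * ‖z.1 - z.2‖ ^ 2) ∂π :=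
  iInf₂_le π hπ

/-- Needed because the dual integrand may be negative: passing to its positive part only increases
the integral. -/
theorem ofReal_integral_le_lintegral_ofReal {α : Type*} [MeasurableSpace α] {μ : Measure α}
    {f g : α → ℝ} (hf : Integrable f μ) (hfg : ∀ᵐ x ∂μ, f x ≤ g x) :
    ENNReal.ofReal (∫ x, f x ∂μ) ≤ ∫⁻ x, ENNReal.ofReal (g x) ∂μ := by
  have h1 : ∫ x, f x ∂μ ≤ ∫ x, max (f x) 0 ∂μ :=
    integral_mono hf hf.pos_part fun x => le_max_left _ _
  refine (ENNReal.ofReal_le_ofReal h1).trans ?_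
  rw [ofReal_integral_eq_lintegral_ofReal hf.pos_part (ae_of_all _ fun x => le_max_right _ _)]
  refine lintegral_mono_ae ?_
  filter_upwards [hfg] with x hx
  rw [ENNReal.ofReal_max]
  simpa using ENNReal.ofReal_le_ofReal hx

namespace IsHyperplaneNull

variable [Nonempty (Fin N)] (hν : IsHyperplaneNull Ω ν)
include hν

/-- Weak duality. -/
theorem ofReal_kantorovich_le_wassersteinSq {z : Config N d × Dual N}
    (hz : Function.Injective z.1) :
    ENNReal.ofReal (kantorovich ν z) ≤ wassersteinSq (empiricalMeasure z.1) ν := by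
  have := hν.isProbabilityMeasure
  have := isProbabilityMeasure_empiricalMeasure z.1
  refine le_iInf₂ fun π hπ => ?_
  have hfst := hπ.1
  have hsnd := hπ.2
  -- The dual vector as a function on space supported at the agents; distinctness makes its value at
  -- `p_i` equal to `φ_i`.
  set g : Space d → ℝ := fun y => ∑ i, indicator {z.1 i} (fun _ => z.2 i) y with hg
  have hgi : ∀ i, g (z.1 i) = z.2 i := fun i => by
    simp only [hg]
    rw [Finset.sum_eq_single i]
    · simp
    · intro j _ hj
      exact indicator_of_notMem (fun h => hj (hz (by simpa using h.symm))) _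
    · simp
  have hgm : Measurable g := Finset.measurable_fun_sum _ fun i _ =>
    measurable_const.indicator (measurableSet_singleton _)
  have hgint : Integrable g (empiricalMeasure z.1) :=
    integrable_finsetSum _ fun i _ => (integrable_const _).indicator (measurableSet_singleton _)
  have hg1 : Integrable (fun y : Space d × Space d => g y.1) π := by
    rw [← hfst] at hgint
    exact hgint.comp_measurable measurable_fst
  have hm1 : Integrable (fun y : Space d × Space d => minCost z y.2) π := by
    have h := hν.integrable_of_continuous (continuous_minCost z)
    rw [← hsnd] at h
    exact h.comp_measurable measurable_snd
  have hval : kantorovich ν z = ∫ y, (g y.1 + minCost z y.2) ∂π := by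
    rw [integral_add hg1 hm1]
    have e1 : ∫ y, g y.1 ∂π = ∫ x, g x ∂(empiricalMeasure z.1) := by
      rw [← hfst, integral_map measurable_fst.aemeasurable hgm.aestronglyMeasurable]
    have e2 : ∫ y, minCost z y.2 ∂π = ∫ x, minCost z x ∂ν := by
      rw [← hsnd, integral_map measurable_snd.aemeasurable
        (continuous_minCost z).aestronglyMeasurable]
    rw [e1, e2, integral_empiricalMeasure, kantorovich, add_comm]
    simp_rw [hgi]
  have hsupp : ∀ᵐ y ∂π, ∃ i, y.1 = z.1 i := by
    have hS : MeasurableSet (range z.1) := (finite_range z.1).measurableSet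
    have h0 : ∀ᵐ x ∂(empiricalMeasure z.1), x ∈ range z.1 := by
      rw [ae_iff]
      change empiricalMeasure z.1 (range z.1)ᶜ = 0
      simp [empiricalMeasure, hS.compl]
    rw [← hfst] at h0
    filter_upwards [ae_of_ae_map measurable_fst.aemeasurable h0] with y ⟨i, hi⟩
    exact ⟨i, hi.symm⟩
  rw [hval]
  refine ofReal_integral_le_lintegral_ofReal (hg1.add hm1) ?_
  filter_upwards [hsupp] with y ⟨i, hi⟩
  have := minCost_le z i y.2
  rw [hi, hgi]
  simp only [powerCost] at this
  linarith

theorem sum_restrict_laguerreCell {z : Config N d × Dual N} (hz : Function.Injective z.1) :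
    ∑ i, ν.restrict (laguerreCell Ω z.1 z.2 i) = ν := by
  have h := Measure.restrict_iUnion_ae (μ := ν) (s := fun i => laguerreCell Ω z.1 z.2 i)
    (fun i j hij => ?_)
    (fun i => (measurableSet_laguerreCell hν.isCompact z.1 z.2 i).nullMeasurableSet)
  · rw [laguerreCell_iUnion, Measure.restrict_eq_self_of_ae_mem hν.ae_mem, Measure.sum_fintype]
      at h
    exact h.symm
  · change ν _ = 0
    have h := hν.ae_exists_strict_min hz
    rw [ae_iff] at h
    refine measure_mono_null (fun x hx => ?_) h
    intro hx'
    obtain ⟨hxΩ, k, hk⟩ := hx'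
    by_cases hik : i = k
    · exact notMem_laguerreCell_of_strict_min (fun h => hij (hik.trans h.symm)) hk hx.2
    · exact notMem_laguerreCell_of_strict_min hik hk hx.1

/-- The cells of a dual vector with equal masses define a transport plan towards any
configuration. -/
theorem wassersteinSq_le_of_equal_mass {z : Config N d × Dual N} (hz : Function.Injective z.1)
    (hmass : ∀ i, ν.real (laguerreCell Ω z.1 z.2 i) = 1 / (N : ℝ)) (q : Config N d) :
    wassersteinSq (empiricalMeasure q) ν ≤ ENNReal.ofReal
      (∑ i, ∫ x in laguerreCell Ω z.1 z.2 i, (1 / 2) * ‖q i - x‖ ^ 2 ∂ν) := by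
  have := hν.isProbabilityMeasure
  have hNpos := Fin.pos_iff_nonempty.2 ‹Nonempty (Fin N)›
  have hmk : ∀ i, Measurable fun x : Space d => (q i, x) := fun i => by fun_prop
  have hc : (∑ i, (ν.restrict (laguerreCell Ω z.1 z.2 i)).map fun x => (q i, x))
      ∈ couplings (empiricalMeasure q) ν := by
    constructor
    · rw [Measure.map_finset_sum measurable_fst.aemeasurable, empiricalMeasure, Finset.smul_sum]
      refine Finset.sum_congr rfl fun i _ => ?_
      rw [Measure.map_map measurable_fst (hmk i)]
      have : (Prod.fst ∘ fun x : Space d => (q i, x)) = fun _ => q i := rfl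
      rw [this, Measure.map_const, Measure.restrict_apply_univ]
      congr 1
      have h := hmass i
      rw [← ofReal_measureReal, h, one_div, ENNReal.ofReal_inv_of_pos (by exact_mod_cast hNpos)]
      simp
    · rw [Measure.map_finset_sum measurable_snd.aemeasurable]
      conv_rhs => rw [← hν.sum_restrict_laguerreCell hz]
      refine Finset.sum_congr rfl fun i _ => ?_
      rw [Measure.map_map measurable_snd (hmk i)]
      exact Measure.map_id
  refine (wassersteinSq_le hc).trans_eq ?_
  rw [lintegral_finsetSum_measure, ENNReal.ofReal_sum_of_nonneg]
  · refine Finset.sum_congr rfl fun i _ => ?_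
    rw [lintegral_map (by fun_prop) (hmk i), ofReal_integral_eq_lintegral_ofReal]
    · exact (hν.integrable_of_continuous (by fun_prop)).integrableOn
    · exact ae_of_all _ fun x => by positivity
  · exact fun i _ => integral_nonneg fun x => by positivity

/-- Weak duality gives one inequality. In the other, the plan built from the cells costs exactly the
functional, since the multipliers `1/N - a_i` vanish. -/
theorem wassersteinSq_eq_ofReal_kantorovich {z : Config N d × Dual N}
    (hz : Function.Injective z.1)
    (hmass : ∀ i, ν.real (laguerreCell Ω z.1 z.2 i) = 1 / (N : ℝ)) :
    wassersteinSq (empiricalMeasure z.1) ν = ENNReal.ofReal (kantorovich ν z) := by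
  refine le_antisymm ?_ (hν.ofReal_kantorovich_le_wassersteinSq hz)
  refine (hν.wassersteinSq_le_of_equal_mass hz hmass z.1).trans_eq ?_
  rw [hν.kantorovich_eq hz]
  simp [hmass]

theorem kantorovich_nonneg_of_equal_mass {z : Config N d × Dual N}
    (hz : Function.Injective z.1)
    (hmass : ∀ i, ν.real (laguerreCell Ω z.1 z.2 i) = 1 / (N : ℝ)) : 0 ≤ kantorovich ν z := by
  rw [hν.kantorovich_eq hz]
  refine Finset.sum_nonneg fun i _ => ?_
  rw [hmass, sub_self, zero_mul, add_zero]
  exact integral_nonneg fun x => by positivity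

/-! ### Concavity in the dual variable and existence of maximizers. -/

/-- The partial derivatives in `φ` form a supergradient. -/
theorem kantorovich_le_add {p : Config N d} (hp : Function.Injective p) (φ ψ : Dual N) :
    kantorovich ν (p, ψ) ≤ kantorovich ν (p, φ)
      + ∑ i, (1 / (N : ℝ) - ν.real (laguerreCell Ω p φ i)) * (ψ i - φ i) := by
  have := hν.isProbabilityMeasure
  have hm := fun φ : Dual N => hν.integrable_of_continuous (continuous_minCost (p, φ))
  have h1 : ∫ x, minCost (p, ψ) x ∂ν
      = ∑ i, ∫ x in laguerreCell Ω p φ i, minCost (p, ψ) x ∂ν :=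
    hν.integral_eq_sum_setIntegral (z := (p, φ)) hp (fun _ => continuous_minCost (p, ψ))
      fun _ _ _ => rfl
  have h2 : ∫ x, minCost (p, φ) x ∂ν
      = ∑ i, ∫ x in laguerreCell Ω p φ i, minCost (p, φ) x ∂ν :=
    hν.integral_eq_sum_setIntegral (z := (p, φ)) hp (fun _ => continuous_minCost (p, φ))
      fun _ _ _ => rfl
  have h3 : ∀ i, ∫ x in laguerreCell Ω p φ i, minCost (p, ψ) x ∂ν
      ≤ ∫ x in laguerreCell Ω p φ i, minCost (p, φ) x ∂ν
        + ν.real (laguerreCell Ω p φ i) * (φ i - ψ i) := fun i => by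
    have h4 : ∫ x in laguerreCell Ω p φ i, minCost (p, ψ) x ∂ν
        ≤ ∫ x in laguerreCell Ω p φ i, (minCost (p, φ) x + (φ i - ψ i)) ∂ν := by
      refine setIntegral_mono_on (hm ψ).integrableOn
        ((hm φ).add (integrable_const _)).integrableOn
        (measurableSet_laguerreCell hν.isCompact p φ i) fun x hx => ?_
      rw [minCost_eq_of_forall_le (z := (p, φ)) hx.2]
      have := minCost_le (p, ψ) i x
      simp only [powerCost] at this ⊢
      linarith
    rw [integral_add (hm φ).integrableOn (integrable_const _)] at h4
    simpa using h4
  have h5 := Finset.sum_le_sum fun i (_ : i ∈ Finset.univ) => h3 i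
  rw [Finset.sum_add_distrib, ← h1, ← h2] at h5
  have h6 : ∑ i, (1 / (N : ℝ) - ν.real (laguerreCell Ω p φ i)) * (ψ i - φ i)
      = (1 / (N : ℝ)) * ∑ i, ψ i - (1 / (N : ℝ)) * ∑ i, φ i
        + ∑ i, ν.real (laguerreCell Ω p φ i) * (φ i - ψ i) := by
    rw [← mul_sub, ← Finset.sum_sub_distrib, Finset.mul_sum, ← Finset.sum_add_distrib]
    exact Finset.sum_congr rfl fun i _ => by ring
  rw [h6]
  simp only [kantorovich]
  linarith

/-- Apply the supergradient inequality at the convex combination; the two linear terms cancel. -/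
theorem concaveOn_kantorovich {p : Config N d} (hp : Function.Injective p) :
    ConcaveOn ℝ univ fun φ : Dual N => kantorovich ν (p, φ) := by
  refine ⟨convex_univ, fun φ _ ψ _ a b ha hb hab => ?_⟩
  set χ := a • φ + b • ψ with hχ
  have h1 := mul_le_mul_of_nonneg_left (hν.kantorovich_le_add hp χ φ) ha
  have h2 := mul_le_mul_of_nonneg_left (hν.kantorovich_le_add hp χ ψ) hb
  set w : Dual N := fun i => 1 / (N : ℝ) - ν.real (laguerreCell Ω p χ i) with hw
  have h3 : a * ∑ i, w i * (φ i - χ i) + b * ∑ i, w i * (ψ i - χ i) = 0 := by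
    rw [Finset.mul_sum, Finset.mul_sum, ← Finset.sum_add_distrib]
    refine Finset.sum_eq_zero fun i _ => ?_
    have : χ i = a * φ i + b * ψ i := by simp [hχ]
    rw [this]
    have hb' : b = 1 - a := by linarith
    subst hb'
    ring
  simp only [smul_eq_mul]
  have h4 : (a + b) * kantorovich ν (p, χ) = kantorovich ν (p, χ) := by rw [hab, one_mul]
  simp only [hw] at h3
  linarith

theorem hasFDerivAt_kantorovich_snd {p : Config N d} (hp : Function.Injective p) (φ : Dual N) :
    HasFDerivAt (fun ψ : Dual N => kantorovich ν (p, ψ))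
      ((kantorovichDeriv Ω ν (p, φ)).comp (ContinuousLinearMap.inr ℝ (Config N d) (Dual N))) φ :=
  (hν.hasFDerivAt_kantorovich (z := (p, φ)) hp).comp φ (hasFDerivAt_prodMk_right p φ)

/-- `φ` maximizes the functional if and only if its cells have equal masses. -/
theorem forall_kantorovich_le_iff {p : Config N d} (hp : Function.Injective p) (φ : Dual N) :
    (∀ ψ, kantorovich ν (p, ψ) ≤ kantorovich ν (p, φ)) ↔
      ∀ i, ν.real (laguerreCell Ω p φ i) = 1 / (N : ℝ) := by
  constructor
  · intro h i
    have hd := hν.hasFDerivAt_kantorovich_snd hp φ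
    have hmax : IsLocalMax (fun ψ : Dual N => kantorovich ν (p, ψ)) φ :=
      Eventually.of_forall h
    have h0 := hmax.hasFDerivAt_eq_zero hd
    have h1 := congrArg (fun L => L (Pi.single i 1)) h0
    simp only [ContinuousLinearMap.comp_apply, ContinuousLinearMap.inr_apply,
      kantorovichDeriv_apply, Pi.zero_apply, inner_zero_right, zero_add, zero_apply] at h1
    rw [Finset.sum_eq_single i] at h1
    · simp at h1 ⊢; linarith
    · intro j _ hj
      simp [hj]
    · simp
  · intro h ψ
    have := hν.kantorovich_le_add hp φ ψ
    simpa [h] using this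

/-- The minimum drops by `c` and the mean of `φ` rises by `c`; the two cancel because the total mass
is one. -/
theorem kantorovich_add_const (p : Config N d) (φ : Dual N) (c : ℝ) :
    kantorovich ν (p, fun i => φ i + c) = kantorovich ν (p, φ) := by
  have := hν.isProbabilityMeasure
  have hNpos := Fin.pos_iff_nonempty.2 ‹Nonempty (Fin N)›
  have h : ∀ x, minCost (p, fun i => φ i + c) x = minCost (p, φ) x - c := fun x => by
    refine le_antisymm ?_ ?_
    · obtain ⟨i, hi⟩ := exists_minCost_eq (p, φ) x
      have := minCost_le (p, fun i => φ i + c) i x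
      simp only [hi, powerCost] at this ⊢
      linarith
    · refine le_minCost_iff.2 fun i => ?_
      have := minCost_le (p, φ) i x
      simp only [powerCost] at this ⊢
      linarith
  simp only [kantorovich, h]
  rw [integral_sub (hν.integrable_of_continuous (continuous_minCost _)) (integrable_const _)]
  simp only [Finset.sum_add_distrib, integral_const, probReal_univ, smul_eq_mul, Finset.sum_const,
    Finset.card_univ, Fintype.card_fin, nsmul_eq_mul]
  have : (N : ℝ) ≠ 0 := by exact_mod_cast hNpos.ne'
  field_simp
  ring

theorem exists_forall_kantorovich_le {p : Config N d} (hp : Function.Injective p) :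
    ∃ φ : Dual N, ∀ ψ, kantorovich ν (p, ψ) ≤ kantorovich ν (p, φ) := by
  have hNpos := Fin.pos_iff_nonempty.2 ‹Nonempty (Fin N)›
  have hNpos' : (0 : ℝ) < N := by exact_mod_cast hNpos
  set C : ℝ := ∫ x, ∑ j, (1 / 2) * ‖p j - x‖ ^ 2 ∂ν with hC
  -- Chosen so that a nonpositive vector with maximum `0` and some entry below `-M` does no better
  -- than `φ = 0`: its minimum cost integrates to at most `C`, and its mean is at most `-(C -
  -- kantorovich ν (p, 0))`.
  set M : ℝ := max 0 (N * (C - kantorovich ν (p, 0))) with hM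
  have hM0 : 0 ≤ M := le_max_left _ _
  have hcont : Continuous fun φ : Dual N => kantorovich ν (p, φ) := by
    refine continuous_iff_continuousAt.2 fun φ => ?_
    exact ContinuousAt.comp (g := kantorovich ν) (f := fun φ : Dual N => (p, φ))
      (hν.hasFDerivAt_kantorovich (z := (p, φ)) hp).continuousAt (by fun_prop)
  obtain ⟨φ, hφ, hmax⟩ := (isCompact_Icc (a := fun _ : Fin N => -M) (b := 0)).exists_isMaxOn
    ⟨0, fun i => by simpa using hM0, le_rfl⟩ hcont.continuousOn
  refine ⟨φ, fun ψ => ?_⟩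
  obtain ⟨k, -, hk⟩ := Finset.exists_mem_eq_sup' (s := Finset.univ) Finset.univ_nonempty ψ
  have hle : ∀ i, ψ i ≤ ψ k := fun i => hk ▸ Finset.le_sup' ψ (Finset.mem_univ i)
  -- Shift so that the largest entry is `0`: then either the vector lies in the box, or some entry
  -- is below `-M`.
  rw [← hν.kantorovich_add_const p ψ (-ψ k)]
  set χ : Dual N := fun i => ψ i + -ψ k with hχ
  have hχ0 : ∀ i, χ i ≤ 0 := fun i => by simp only [hχ]; linarith [hle i]
  by_cases hcase : ∀ i, -M ≤ χ i
  · exact hmax (a := χ) ⟨hcase, hχ0⟩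
  push Not at hcase
  obtain ⟨l, hl⟩ := hcase
  have h0 : kantorovich ν (p, 0) ≤ kantorovich ν (p, φ) :=
    hmax (a := 0) ⟨fun i => by simpa using hM0, le_rfl⟩
  refine le_trans ?_ h0
  have h1 : ∫ x, minCost (p, χ) x ∂ν ≤ C := by
    refine integral_mono (hν.integrable_of_continuous (continuous_minCost _))
      (hν.integrable_of_continuous (by fun_prop)) fun x => ?_
    refine (minCost_le (p, χ) k x).trans ?_
    have h2 : χ k = 0 := by simp [hχ]
    have h3 := Finset.single_le_sum (f := fun j => (1 / 2) * ‖p j - x‖ ^ 2)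
      (fun j _ => by positivity) (Finset.mem_univ k)
    simpa [powerCost, h2] using h3
  have h4 : ∑ i, χ i ≤ χ l := by
    rw [← Finset.sum_erase_add _ _ (Finset.mem_univ l)]
    linarith [Finset.sum_nonpos fun i (_ : i ∈ Finset.univ.erase l) => hχ0 i]
  have h5 : (1 / (N : ℝ)) * ∑ i, χ i ≤ (1 / (N : ℝ)) * (-(N * (C - kantorovich ν (p, 0)))) := by
    refine mul_le_mul_of_nonneg_left ?_ (by positivity)
    linarith [le_max_right 0 (N * (C - kantorovich ν (p, 0)))]
  have h6 : (1 / (N : ℝ)) * (-(N * (C - kantorovich ν (p, 0)))) = -(C - kantorovich ν (p, 0)) := by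
    field_simp
  rw [h6] at h5
  simp only [kantorovich] at h1 h5 ⊢
  linarith

theorem exists_equal_mass {p : Config N d} (hp : Function.Injective p) :
    ∃ φ : Dual N, ∀ i, ν.real (laguerreCell Ω p φ i) = 1 / (N : ℝ) := by
  obtain ⟨φ, hφ⟩ := hν.exists_forall_kantorovich_le hp
  exact ⟨φ, (hν.forall_kantorovich_le_iff hp φ).1 hφ⟩

theorem wassersteinSq_ne_top {p : Config N d} (hp : Function.Injective p) :
    wassersteinSq (empiricalMeasure p) ν ≠ ⊤ := by
  obtain ⟨φ, hφ⟩ := hν.exists_equal_mass hp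
  rw [hν.wassersteinSq_eq_ofReal_kantorovich (z := (p, φ)) hp hφ]
  exact ENNReal.ofReal_ne_top

theorem toReal_wassersteinSq {p : Config N d} (hp : Function.Injective p) {φ : Dual N}
    (hφ : ∀ i, ν.real (laguerreCell Ω p φ i) = 1 / (N : ℝ)) :
    (wassersteinSq (empiricalMeasure p) ν).toReal = kantorovich ν (p, φ) := by
  rw [hν.wassersteinSq_eq_ofReal_kantorovich (z := (p, φ)) hp hφ,
    ENNReal.toReal_ofReal (hν.kantorovich_nonneg_of_equal_mass (z := (p, φ)) hp hφ)]

end IsHyperplaneNull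

/-! ### The second-derivative test. -/

/-- A critical point around which the second derivative is positive definite is a strict local
minimizer. -/
theorem eventually_lt_of_fderiv_fderiv_pos {E : Type*} [NormedAddCommGroup E] [NormedSpace ℝ E]
    {f : E → ℝ} {p : E} (hf : ∀ᶠ q in 𝓝 p, DifferentiableAt ℝ f q) (h0 : fderiv ℝ f p = 0)
    (hpos : ∀ᶠ q in 𝓝 p, ∀ v, v ≠ 0 → 0 < fderiv ℝ (fderiv ℝ f) q v v) :
    ∀ᶠ q in 𝓝[≠] p, f p < f q := by
  obtain ⟨r, hr, hball⟩ := Metric.eventually_nhds_iff_ball.1 (hf.and hpos)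
  filter_upwards [nhdsWithin_le_nhds (Metric.ball_mem_nhds p hr), self_mem_nhdsWithin]
    with q hq hqp
  set v := q - p with hv
  have hv0 : v ≠ 0 := sub_ne_zero.2 hqp
  have hmem : ∀ s ∈ Icc (0 : ℝ) 1, p + s • v ∈ Metric.ball p r := fun s hs => by
    rw [mem_ball_iff_norm, add_sub_cancel_left, norm_smul, Real.norm_of_nonneg hs.1]
    rw [mem_ball_iff_norm] at hq
    nlinarith [norm_nonneg v, hs.2]
  have hline : ∀ s : ℝ, HasDerivAt (fun s : ℝ => p + s • v) v s := fun s => by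
    simpa using ((hasDerivAt_id s).smul_const v).const_add p
  have hd1 : ∀ s ∈ Icc (0 : ℝ) 1,
      HasDerivAt (fun s => f (p + s • v)) (fderiv ℝ f (p + s • v) v) s := fun s hs =>
    (hball _ (hmem s hs)).1.hasFDerivAt.comp_hasDerivAt s (hline s)
  have hd2 : ∀ s ∈ Icc (0 : ℝ) 1, HasDerivAt (fun s => fderiv ℝ f (p + s • v) v)
      (fderiv ℝ (fderiv ℝ f) (p + s • v) v v) s := fun s hs => by
    have hdiff : DifferentiableAt ℝ (fderiv ℝ f) (p + s • v) := by
      -- At a point of nondifferentiability `fderiv` takes the default value zero, which contradicts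
      -- positivity; so the hypothesis itself supplies second differentiability.
      by_contra hnd
      have := (hball _ (hmem s hs)).2 v hv0
      rw [fderiv_zero_of_not_differentiableAt hnd] at this
      simp at this
    have h := hdiff.hasFDerivAt.comp_hasDerivAt s (hline s)
    simpa using h.clm_apply (hasDerivAt_const s v)
  have hmono1 : StrictMonoOn (fun s : ℝ => fderiv ℝ f (p + s • v) v) (Icc 0 1) := by
    refine strictMonoOn_of_deriv_pos (convex_Icc 0 1)
      (fun s hs => (hd2 s hs).continuousAt.continuousWithinAt) fun s hs => ?_
    rw [interior_Icc] at hs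
    rw [(hd2 s (Ioo_subset_Icc_self hs)).deriv]
    exact (hball _ (hmem s (Ioo_subset_Icc_self hs))).2 v hv0
  have hmono : StrictMonoOn (fun s : ℝ => f (p + s • v)) (Icc 0 1) := by
    refine strictMonoOn_of_deriv_pos (convex_Icc 0 1)
      (fun s hs => (hd1 s hs).continuousAt.continuousWithinAt) fun s hs => ?_
    rw [interior_Icc] at hs
    rw [(hd1 s (Ioo_subset_Icc_self hs)).deriv]
    have := hmono1 (left_mem_Icc.2 zero_le_one) (Ioo_subset_Icc_self hs) hs.1
    simpa [h0] using this
  simpa [hv] using hmono (left_mem_Icc.2 zero_le_one) (right_mem_Icc.2 zero_le_one) zero_lt_one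

/-! ### The frozen dual flow and local minimizers of the cost. -/

namespace IsHyperplaneNull

variable [Nonempty (Fin N)] (hν : IsHyperplaneNull Ω ν)
include hν

/-- Along the gradient flow in `φ` the functional converges to its maximum, and the trajectory is
bounded. -/
theorem tendsto_kantorovich_of_gradient_flow {p : Config N d} (hp : Function.Injective p)
    {K : ℝ} (hK : 0 < K) {φ : Dual N} (hφ : ∀ χ, kantorovich ν (p, χ) ≤ kantorovich ν (p, φ))
    {ψ : ℝ → Dual N}
    (hψ : ∀ s, 0 ≤ s → ∀ i, HasDerivWithinAt (fun r => ψ r i)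
      (K * (1 / (N : ℝ) - ν.real (laguerreCell Ω p (ψ s) i))) (Ici 0) s) :
    Tendsto (fun s => kantorovich ν (p, ψ s)) atTop (𝓝 (kantorovich ν (p, φ))) ∧
      ∃ R, ∀ s, 0 ≤ s → ψ s ∈ Metric.closedBall φ R := by
  set w : ℝ → Fin N → ℝ := fun s i => 1 / (N : ℝ) - ν.real (laguerreCell Ω p (ψ s) i) with hw
  set D : ℝ → ℝ := fun s => ∑ i, (ψ s i - φ i) ^ 2 with hD
  set g : ℝ → ℝ := fun s => kantorovich ν (p, φ) - kantorovich ν (p, ψ s) with hg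
  have hg0 : ∀ s, 0 ≤ g s := fun s => sub_nonneg.2 (hφ (ψ s))
  have hDder : ∀ s, 0 ≤ s →
      HasDerivWithinAt D (∑ i, 2 * (ψ s i - φ i) * (K * w s i)) (Ici 0) s := fun s hs => by
    refine HasDerivWithinAt.fun_sum fun i _ => ?_
    simpa [hw] using ((hψ s hs i).sub_const (φ i)).fun_pow 2
  have hgder : ∀ s, 0 ≤ s → HasDerivWithinAt g (-∑ i, w s i * (K * w s i)) (Ici 0) s := by
    intro s hs
    have h1 : HasDerivWithinAt ψ (fun i => K * w s i) (Ici 0) s :=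
      hasDerivWithinAt_pi.2 fun i => hψ s hs i
    have h2 := (hν.hasFDerivAt_kantorovich_snd hp (ψ s)).comp_hasDerivWithinAt s h1
    have h3 := h2.const_sub (kantorovich ν (p, φ))
    refine h3.congr_deriv ?_
    simp [kantorovichDeriv_apply, hw]
  -- The supergradient inequality at `ψ s`, tested against the maximizer `φ`.
  have hDle : ∀ s, ∑ i, 2 * (ψ s i - φ i) * (K * w s i) ≤ -(2 * K * g s) := fun s => by
    have h1 := hν.kantorovich_le_add hp (ψ s) φ
    have h2 : ∑ i, 2 * (ψ s i - φ i) * (K * w s i)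
        = -(2 * K * ∑ i, w s i * (φ i - ψ s i)) := by
      rw [Finset.mul_sum, ← Finset.sum_neg_distrib]
      exact Finset.sum_congr rfl fun i _ => by ring
    rw [h2]
    have h3 : g s ≤ ∑ i, w s i * (φ i - ψ s i) := by simp only [hg, hw]; linarith
    have := mul_le_mul_of_nonneg_left h3 (by positivity : 0 ≤ 2 * K)
    linarith
  -- The Lyapunov function of gradient ascent: `D` loses at least `2K g`, which compensates the
  -- derivative of the factor `s`, and `g` itself decreases. It yields both the rate `D 0 / (2K s)`
  -- and the bound on the trajectory.
  have hanti : AntitoneOn (fun s => D s + 2 * K * (s * g s)) (Ici 0) := by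
    have hder : ∀ s, 0 ≤ s → HasDerivWithinAt (fun s => D s + 2 * K * (s * g s))
        (∑ i, 2 * (ψ s i - φ i) * (K * w s i)
          + 2 * K * (1 * g s + s * -∑ i, w s i * (K * w s i))) (Ici 0) s := fun s hs =>
      (hDder s hs).add (((hasDerivWithinAt_id s _).mul (hgder s hs)).const_mul (2 * K))
    refine antitoneOn_of_deriv_nonpos (convex_Ici 0)
      (fun s hs => (hder s hs).continuousWithinAt) (fun s hs => ?_) fun s hs => ?_
    all_goals rw [interior_Ici] at hs
    · exact ((hder s (le_of_lt hs)).hasDerivAt (Ici_mem_nhds hs)).differentiableAt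
        |>.differentiableWithinAt
    · rw [((hder s (le_of_lt hs)).hasDerivAt (Ici_mem_nhds hs)).deriv]
      have h1 : 0 ≤ ∑ i, w s i * (K * w s i) := Finset.sum_nonneg fun i _ => by
        have := mul_nonneg hK.le (mul_self_nonneg (w s i))
        linarith
      have h2 := mul_nonneg (mul_nonneg hK.le (le_of_lt (mem_Ioi.1 hs))) h1
      have h3 := hDle s
      linarith
  have hbound : ∀ s, 0 ≤ s → D s + 2 * K * (s * g s) ≤ D 0 := fun s hs => by
    simpa using hanti (mem_Ici.2 le_rfl) (mem_Ici.2 hs) hs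
  have hD0 : ∀ s, 0 ≤ D s := fun s => Finset.sum_nonneg fun i _ => sq_nonneg _
  constructor
  · have h1 : Tendsto g atTop (𝓝 0) := by
      have h2 : Tendsto (fun s : ℝ => D 0 / (2 * K) / s) atTop (𝓝 0) :=
        tendsto_const_nhds.div_atTop tendsto_id
      refine tendsto_of_tendsto_of_tendsto_of_le_of_le' tendsto_const_nhds h2
        (Eventually.of_forall hg0) ?_
      filter_upwards [eventually_gt_atTop 0] with s hs
      rw [le_div_iff₀ hs, le_div_iff₀ (by positivity)]
      linarith [hbound s hs.le, hD0 s]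
    have h3 := h1.const_sub (kantorovich ν (p, φ))
    simpa [hg] using h3
  · refine ⟨√(D 0), fun s hs => ?_⟩
    rw [mem_closedBall_iff_norm, pi_norm_le_iff_of_nonneg (Real.sqrt_nonneg _)]
    intro i
    refine Real.le_sqrt_of_sq_le ?_
    have h1 : (ψ s i - φ i) ^ 2 ≤ D s :=
      Finset.single_le_sum (f := fun i => (ψ s i - φ i) ^ 2) (fun _ _ => sq_nonneg _)
        (Finset.mem_univ i)
    have h2 := mul_nonneg (mul_nonneg (by norm_num : (0 : ℝ) ≤ 2) hK.le)
      (mul_nonneg hs (hg0 s))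
    simpa using h1.trans (by linarith [hbound s hs])

/-- In a bounded region, vectors with a mass at distance at least `ε` from `1/N` form a compact set
without maximizers, so the functional stays below its maximum by a positive amount there. -/
theorem tendsto_mass_of_tendsto_kantorovich {p : Config N d} (hp : Function.Injective p)
    {φ : Dual N} (hφ : ∀ χ, kantorovich ν (p, χ) ≤ kantorovich ν (p, φ))
    {ψ : ℝ → Dual N}
    (hψ : Tendsto (fun s => kantorovich ν (p, ψ s)) atTop (𝓝 (kantorovich ν (p, φ))))
    {R : ℝ} (hR : ∀ s, 0 ≤ s → ψ s ∈ Metric.closedBall φ R) (i : Fin N) :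
    Tendsto (fun s => ν.real (laguerreCell Ω p (ψ s) i)) atTop (𝓝 (1 / (N : ℝ))) := by
  have hmass : Continuous fun χ : Dual N => ν.real (laguerreCell Ω p χ i) :=
    continuous_iff_continuousAt.2 fun χ =>
      ContinuousAt.comp (g := fun w : Config N d × Dual N => ν.real (laguerreCell Ω w.1 w.2 i))
        (f := fun χ : Dual N => (p, χ))
        (hν.continuousAt_measureReal_laguerreCell (z := (p, χ)) hp i) (by fun_prop)
  have hcont : Continuous fun χ : Dual N => kantorovich ν (p, χ) :=
    continuous_iff_continuousAt.2 fun χ => (hν.hasFDerivAt_kantorovich_snd hp χ).continuousAt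
  refine Metric.tendsto_nhds.2 fun ε hε => ?_
  have hcpt : IsCompact (Metric.closedBall φ R ∩
      {χ | ε ≤ dist (ν.real (laguerreCell Ω p χ i)) (1 / (N : ℝ))}) :=
    (isCompact_closedBall φ R).inter_right
      (isClosed_le continuous_const (hmass.dist continuous_const))
  rcases eq_empty_or_nonempty (Metric.closedBall φ R ∩
      {χ | ε ≤ dist (ν.real (laguerreCell Ω p χ i)) (1 / (N : ℝ))}) with hemp | hne
  · filter_upwards [eventually_ge_atTop 0] with s hs
    by_contra hcon
    have : ψ s ∈ (∅ : Set (Dual N)) := hemp ▸ ⟨hR s hs, not_lt.1 hcon⟩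
    exact this
  · obtain ⟨χ, hχ, hmax⟩ := hcpt.exists_isMaxOn hne hcont.continuousOn
    have hlt : kantorovich ν (p, χ) < kantorovich ν (p, φ) := by
      refine lt_of_le_of_ne (hφ χ) fun heq => ?_
      have h1 := (hν.forall_kantorovich_le_iff hp χ).1 (fun θ => heq ▸ hφ θ) i
      have h2 : ε ≤ dist (ν.real (laguerreCell Ω p χ i)) (1 / (N : ℝ)) := hχ.2
      rw [h1, dist_self] at h2
      linarith
    filter_upwards [eventually_ge_atTop 0, hψ.eventually (lt_mem_nhds hlt)] with s hs hs'
    by_contra hcon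
    exact absurd (hmax ⟨hR s hs, not_lt.1 hcon⟩) (not_le.2 hs')

/-- A local minimizer of the transport cost over `Ω^N` is at the barycenters of the cells of any
dual vector with equal masses. -/
theorem eq_barycenter_of_isLocalMinOn (hΩ : Convex ℝ Ω) {p : Config N d}
    (hp : Function.Injective p) (hpΩ : ∀ i, p i ∈ Ω)
    (hmin : IsLocalMinOn (fun q : Config N d => wassersteinSq (empiricalMeasure q) ν)
      {q | ∀ i, q i ∈ Ω} p) {φ : Dual N}
    (hφ : ∀ i, ν.real (laguerreCell Ω p φ i) = 1 / (N : ℝ)) (i : Fin N) :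
    p i = (ν.real (laguerreCell Ω p φ i))⁻¹ • ∫ x in laguerreCell Ω p φ i, x ∂ν := by
  have := hν.isProbabilityMeasure
  have hNpos : (0 : ℝ) < N := by exact_mod_cast Fin.pos_iff_nonempty.2 ‹Nonempty (Fin N)›
  have hmpos : 0 < ν.real (laguerreCell Ω p φ i) := by rw [hφ]; positivity
  set m := ν.real (laguerreCell Ω p φ i) with hm
  set b := m⁻¹ • ∫ x in laguerreCell Ω p φ i, x ∂ν with hb
  have hint : ∀ {F : Type} [NormedAddCommGroup F] {f : Space d → F}, Continuous f →
      Integrable f (ν.restrict (laguerreCell Ω p φ i)) := fun hf =>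
    (hν.integrable_of_continuous hf).integrableOn
  -- The only use of convexity besides the segment below: averages over a cell stay in `Ω`, so
  -- moving towards `b` is admissible.
  have hbΩ : b ∈ Ω := by
    have h := hΩ.set_average_mem (μ := ν) (t := laguerreCell Ω p φ i) (f := fun x => x)
      hν.isCompact.isClosed (fun h0 => by simp [hm, Measure.real, h0] at hmpos)
      (measure_ne_top _ _)
      (by
        filter_upwards [ae_restrict_mem (measurableSet_laguerreCell hν.isCompact p φ i)] with x hx
        exact hx.1) (hint continuous_id)
    rwa [setAverage_eq] at h
  by_contra hne
  have hpos : 0 < ‖b - p i‖ ^ 2 := by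
    have := norm_pos_iff.2 (sub_ne_zero.2 (Ne.symm hne))
    positivity
  set q : ℝ → Config N d := fun s => Function.update p i (p i + s • (b - p i)) with hq
  have hq0 : q 0 = p := by simp [hq]
  have hqc : Continuous q := continuous_const.update i (by fun_prop)
  set C : Config N d → ℝ := fun r =>
    ∑ j, ∫ x in laguerreCell Ω p φ j, (1 / 2) * ‖r j - x‖ ^ 2 ∂ν with hC
  have hCnn : ∀ r, 0 ≤ C r := fun r =>
    Finset.sum_nonneg fun j _ => integral_nonneg fun x => by positivity
  have hWp : wassersteinSq (empiricalMeasure p) ν = ENNReal.ofReal (C p) := by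
    rw [hν.wassersteinSq_eq_ofReal_kantorovich (z := (p, φ)) hp hφ,
      hν.kantorovich_eq (z := (p, φ)) hp]
    simp only [hφ, sub_self, zero_mul, add_zero, hC]
  -- With the cells frozen, the cost is exactly quadratic along the segment, and `s ^ 2 / 2 - s` is
  -- negative for small `s > 0`.
  have hCq : ∀ s : ℝ, C (q s) = C p + m * ‖b - p i‖ ^ 2 * (s ^ 2 / 2 - s) := fun s => by
    have h1 : ∀ r : Config N d, C r = (∫ x in laguerreCell Ω p φ i, (1 / 2) * ‖r i - x‖ ^ 2 ∂ν)
        + ∑ j ∈ Finset.univ.erase i, ∫ x in laguerreCell Ω p φ j, (1 / 2) * ‖r j - x‖ ^ 2 ∂ν :=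
      fun r => (Finset.add_sum_erase _ _ (Finset.mem_univ i)).symm
    have h2 : ∑ j ∈ Finset.univ.erase i,
          ∫ x in laguerreCell Ω p φ j, (1 / 2) * ‖q s j - x‖ ^ 2 ∂ν
        = ∑ j ∈ Finset.univ.erase i,
          ∫ x in laguerreCell Ω p φ j, (1 / 2) * ‖p j - x‖ ^ 2 ∂ν := by
      refine Finset.sum_congr rfl fun j hj => ?_
      simp [hq, Function.update_of_ne (Finset.ne_of_mem_erase hj)]
    have h3 : ∀ x, (1 / 2) * ‖q s i - x‖ ^ 2 = (1 / 2) * ‖p i - x‖ ^ 2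
        + (s * inner ℝ (b - p i) (p i) + s ^ 2 / 2 * ‖b - p i‖ ^ 2)
        - s * inner ℝ (b - p i) x := fun x => by
      have : q s i - x = (p i - x) + s • (b - p i) := by simp [hq]; abel
      rw [this, norm_add_sq_real, norm_smul, real_inner_smul_right,
        real_inner_comm, inner_sub_right, mul_pow, Real.norm_eq_abs, sq_abs]
      ring
    have h4 : ∫ x in laguerreCell Ω p φ i, inner ℝ (b - p i) x ∂ν = m * inner ℝ (b - p i) b := by
      rw [integral_inner (f := fun x => x) (hint continuous_id), hb, real_inner_smul_right]
      field_simp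
    rw [h1 (q s), h2, h1 p]
    simp_rw [h3]
    rw [integral_sub (hint (by fun_prop)) (hint (by fun_prop)),
      integral_add (hint (by fun_prop)) (hint (by fun_prop)), integral_const_mul s, h4]
    have h5 : inner ℝ (b - p i) b = inner ℝ (b - p i) (p i) + ‖b - p i‖ ^ 2 := by
      rw [← real_inner_self_eq_norm_sq, ← inner_add_right]
      congr 1; abel
    rw [h5]
    simp only [integral_const, measureReal_restrict_apply_univ, smul_eq_mul, ← hm]
    ring
  have hqΩ : ∀ s ∈ Icc (0 : ℝ) 1, ∀ j, q s j ∈ Ω := fun s hs j => by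
    by_cases hj : j = i
    · subst hj
      simpa [hq] using hΩ.add_smul_sub_mem (hpΩ j) hbΩ hs
    · simpa [hq, Function.update_of_ne hj] using hpΩ j
  have htend : Tendsto q (𝓝[>] 0) (𝓝[{q | ∀ i, q i ∈ Ω}] p) := by
    refine tendsto_nhdsWithin_iff.2 ⟨?_, ?_⟩
    · have := hqc.tendsto 0
      rw [hq0] at this
      exact this.mono_left nhdsWithin_le_nhds
    · filter_upwards [Ioc_mem_nhdsGT zero_lt_one] with s hs
      exact hqΩ s ⟨hs.1.le, hs.2⟩
  have hev := (htend.eventually hmin).and (Ioc_mem_nhdsGT (zero_lt_one' ℝ))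
  obtain ⟨s, hs1, hs2⟩ := hev.exists
  -- The old cells still have mass `1/N`, hence give a plan for the moved agents; this needs no
  -- distinctness of `q s`.
  have h6 : ENNReal.ofReal (C p) ≤ ENNReal.ofReal (C (q s)) := by
    rw [← hWp]
    exact hs1.trans (hν.wassersteinSq_le_of_equal_mass (z := (p, φ)) hp hφ (q s))
  rw [ENNReal.ofReal_le_ofReal_iff (hCnn _), hCq] at h6
  have h7 : 0 < m * ‖b - p i‖ ^ 2 := mul_pos hmpos hpos
  nlinarith [hs2.1, hs2.2, mul_pos h7 hs2.1]

end IsHyperplaneNull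

/-! ### Volumes of slabs and hyperplanes. -/

/-- A slab of width `ε / ‖u‖` inside a ball has volume at most proportional to its width:
`⌈‖u‖ / ε⌉` disjoint translates of it fit into a larger ball. -/
theorem volume_real_slab_le {R : ℝ} {u : Space d} (hu : u ≠ 0) (c : ℝ) {ε : ℝ} (hε : 0 ≤ ε) :
    volume.real {x : Space d | ‖x‖ ≤ R ∧ c ≤ inner ℝ u x ∧ inner ℝ u x < c + ε}
      ≤ ε / ‖u‖ * volume.real (Metric.closedBall (0 : Space d) (R + 2)) := by
  have hu' : 0 < ‖u‖ := norm_pos_iff.2 hu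
  set S := {x : Space d | ‖x‖ ≤ R ∧ c ≤ inner ℝ u x ∧ inner ℝ u x < c + ε} with hS
  set B := Metric.closedBall (0 : Space d) (R + 2) with hB
  have hBtop : volume B ≠ ⊤ := measure_closedBall_lt_top.ne
  have hSm : MeasurableSet S := by
    have h : S = {x | ‖x‖ ≤ R} ∩ ({x | c ≤ inner ℝ u x} ∩ {x | inner ℝ u x < c + ε}) := rfl
    rw [h]
    exact (measurableSet_le measurable_norm measurable_const).inter
      ((measurableSet_le measurable_const (by fun_prop)).inter
        (measurableSet_lt (by fun_prop) measurable_const))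
  rcases hε.eq_or_lt with rfl | hε
  · have : S = ∅ := by
      ext x
      simp only [hS, mem_ofPred_eq, mem_empty_iff_false, iff_false]
      rintro ⟨-, h1, h2⟩
      linarith
    simp [this]
  set M := ⌈‖u‖ / ε⌉₊ with hM
  -- The shift lowers `inner ℝ u x` by `k * ε` in the membership test, so `T k` lies in the slab
  -- from `c + k * ε` to `c + (k + 1) * ε`; the half-open bounds make these disjoint.
  set τ : ℕ → Space d := fun k => (-(k * ε / ‖u‖ ^ 2)) • u with hτ
  set T : ℕ → Set (Space d) := fun k => (fun x => x + τ k) ⁻¹' S with hT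
  have hmemT : ∀ k x, x ∈ T k → x + τ k ∈ S := fun k x hx => hx
  have hinner : ∀ (k : ℕ) (x : Space d),
      inner ℝ u (x + τ k) = inner ℝ u x - k * ε := fun k x => by
    rw [inner_add_right, hτ, real_inner_smul_right, real_inner_self_eq_norm_sq]
    field_simp
    ring
  have hTvol : ∀ k, volume.real (T k) = volume.real S := fun k => by
    simp only [hT, Measure.real, measure_preimage_add_right]
  have hTm : ∀ k, MeasurableSet (T k) := fun k => hSm.preimage (measurable_add_const _)
  have hdisj : ∀ k l, k < l → Disjoint (T k) (T l) := fun k l hkl => by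
    refine Set.disjoint_left.2 fun x hk hl => ?_
    have h1 := (hmemT k x hk).2.2
    have h2 := (hmemT l x hl).2.1
    rw [hinner] at h1 h2
    have h3 : (k : ℝ) + 1 ≤ l := by exact_mod_cast hkl
    nlinarith
  -- Indices below the ceiling satisfy `k < ‖u‖ / ε`, so every shift has length at most `1` and the
  -- radius `R + 2` suffices.
  have hTsub : ∀ k ∈ Finset.range M, T k ⊆ B := fun k hk x hx => by
    have h1 : (k : ℝ) < ‖u‖ / ε := Nat.lt_ceil.1 (Finset.mem_range.1 hk)
    have h2 : k * ε / ‖u‖ ≤ 1 := by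
      rw [div_le_one hu']
      rw [lt_div_iff₀ hε] at h1
      exact h1.le
    have h3 : ‖τ k‖ ≤ 1 := by
      rw [hτ, norm_smul, norm_neg, Real.norm_of_nonneg (by positivity)]
      have : k * ε / ‖u‖ ^ 2 * ‖u‖ = k * ε / ‖u‖ := by field_simp
      rwa [this]
    have h4 : ‖x + τ k‖ ≤ R := (hmemT k x hx).1
    have h5 : ‖x‖ ≤ ‖x + τ k‖ + ‖τ k‖ := by
      simpa using norm_sub_le (x + τ k) (τ k)
    rw [hB, mem_closedBall_zero_iff]
    linarith
  have hsum : (M : ℝ) * volume.real S ≤ volume.real B := by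
    have h1 : volume.real (⋃ k ∈ Finset.range M, T k) = ∑ k ∈ Finset.range M, volume.real (T k) :=
      measureReal_biUnion_finset
        (fun k _ l _ hkl => by
          rcases lt_or_gt_of_ne hkl with h | h
          · exact hdisj k l h
          · exact (hdisj l k h).symm)
        (fun k _ => hTm k)
        (fun k hk => ((measure_mono (hTsub k hk)).trans_lt measure_closedBall_lt_top).ne)
    have h2 : volume.real (⋃ k ∈ Finset.range M, T k) ≤ volume.real B :=
      measureReal_mono (iUnion₂_subset hTsub) hBtop
    rw [h1] at h2
    simpa [hTvol] using h2
  have hMle : ‖u‖ / ε ≤ M := Nat.le_ceil _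
  have h6 : ‖u‖ / ε * volume.real S ≤ volume.real B :=
    (mul_le_mul_of_nonneg_right hMle measureReal_nonneg).trans hsum
  have h7 : volume.real S = ε / ‖u‖ * (‖u‖ / ε * volume.real S) := by field_simp
  rw [h7]
  exact mul_le_mul_of_nonneg_left h6 (by positivity)

/-- The hyperplane piece lies in slabs of arbitrarily small width. -/
theorem volume_inter_hyperplane (hΩ : IsCompact Ω) {u : Space d} (hu : u ≠ 0)
    (c : ℝ) : volume (Ω ∩ {x | inner ℝ u x = c}) = 0 := by
  obtain ⟨R, hR⟩ := hΩ.isBounded.exists_norm_le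
  have htop : ∀ A ⊆ Metric.closedBall (0 : Space d) R, volume A ≠ ⊤ := fun A hA =>
    ((measure_mono hA).trans_lt measure_closedBall_lt_top).ne
  have hsub : Ω ∩ {x | inner ℝ u x = c} ⊆ Metric.closedBall (0 : Space d) R := fun x hx =>
    mem_closedBall_zero_iff.2 (hR x hx.1)
  have hle : ∀ ε : ℝ, 0 < ε → volume.real (Ω ∩ {x | inner ℝ u x = c})
      ≤ ε * (volume.real (Metric.closedBall (0 : Space d) (R + 2)) / ‖u‖) := fun ε hε => by
    have h := volume_real_slab_le (R := R) hu c hε.le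
    have hsub' : Ω ∩ {x | inner ℝ u x = c}
        ⊆ {x | ‖x‖ ≤ R ∧ c ≤ inner ℝ u x ∧ inner ℝ u x < c + ε} := fun x hx => by
      have : inner ℝ u x = c := hx.2
      exact ⟨hR x hx.1, this.ge, by linarith⟩
    exact (measureReal_mono hsub'
      (htop _ fun x hx => mem_closedBall_zero_iff.2 hx.1)).trans (h.trans_eq (by ring))
  have hlim : Tendsto (fun ε : ℝ => ε * (volume.real (Metric.closedBall (0 : Space d) (R + 2))
      / ‖u‖)) (𝓝[>] 0) (𝓝 0) := by
    have h : Continuous fun ε : ℝ => ε * (volume.real (Metric.closedBall (0 : Space d) (R + 2))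
      / ‖u‖) := by fun_prop
    simpa using (h.tendsto 0).mono_left nhdsWithin_le_nhds
  have h0 : volume.real (Ω ∩ {x | inner ℝ u x = c}) ≤ 0 :=
    ge_of_tendsto hlim (by filter_upwards [self_mem_nhdsWithin] with ε hε using hle ε hε)
  exact (measureReal_eq_zero_iff (htop _ hsub)).1 (le_antisymm h0 measureReal_nonneg)

/-! ### Transfer to the target density. -/

namespace IsTargetDensity

variable {ρ : Space d → ℝ → ℝ} (hρ : IsTargetDensity Ω ρ)
include hρ

theorem continuousOn {t : ℝ} (ht : 0 ≤ t) : ContinuousOn (fun x => ρ x t) Ω :=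
  hρ.contDiffOn.continuousOn.comp (f := fun x => (x, t)) (by fun_prop) fun _ hx => ⟨hx, ht⟩

theorem integrableOn (hΩ : IsCompact Ω) {t : ℝ} (ht : 0 ≤ t) :
    IntegrableOn (fun x => ρ x t) Ω :=
  (hρ.continuousOn ht).integrableOn_compact hΩ

theorem isHyperplaneNull_targetMeasure (hΩ : IsCompact Ω) {t : ℝ} (ht : 0 ≤ t) :
    IsHyperplaneNull Ω (targetMeasure Ω ρ t) where
  isProbabilityMeasure := ⟨by
    rw [targetMeasure, withDensity_apply _ MeasurableSet.univ, Measure.restrict_univ,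
      ← ofReal_integral_eq_lintegral_ofReal (hρ.integrableOn hΩ ht), hρ.mass_one t ht,
      ENNReal.ofReal_one]
    filter_upwards [ae_restrict_mem hΩ.measurableSet] with x hx
    exact hρ.nonneg x hx t ht⟩
  isCompact := hΩ
  measure_compl := withDensity_absolutelyContinuous _ _ (by
    rw [Measure.restrict_apply hΩ.measurableSet.compl]; simp)
  measure_hyperplane := fun u c hu => withDensity_absolutelyContinuous _ _ (by
    rw [Measure.restrict_apply (measurableSet_eq_fun (by fun_prop) (by fun_prop)), inter_comm]
    exact volume_inter_hyperplane hΩ hu c)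

theorem setIntegral_targetMeasure (hΩ : IsCompact Ω) {t : ℝ} (ht : 0 ≤ t) {V : Set (Space d)}
    (hV : MeasurableSet V) (hVΩ : V ⊆ Ω) {F : Type*} [NormedAddCommGroup F] [NormedSpace ℝ F]
    (f : Space d → F) :
    ∫ x in V, f x ∂(targetMeasure Ω ρ t) = ∫ x in V, ρ x t • f x := by
  rw [targetMeasure, restrict_withDensity hV, Measure.restrict_restrict hV,
    inter_eq_left.2 hVΩ, integral_withDensity_eq_integral_toReal_smul₀]
  · refine setIntegral_congr_fun hV fun x hx => ?_
    simp only [ENNReal.toReal_ofReal (hρ.nonneg x (hVΩ hx) t ht)]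
  · exact ((hρ.integrableOn hΩ ht).mono_set hVΩ).aestronglyMeasurable.aemeasurable.ennreal_ofReal
  · exact ae_of_all _ fun x => ENNReal.ofReal_lt_top

theorem cellMass_eq (hΩ : IsCompact Ω) {t : ℝ} (ht : 0 ≤ t) (p : Config N d) (φ : Dual N)
    (i : Fin N) :
    cellMass Ω ρ p φ t i = (targetMeasure Ω ρ t).real (laguerreCell Ω p φ i) := by
  have h := hρ.setIntegral_targetMeasure hΩ ht (measurableSet_laguerreCell hΩ p φ i)
    (laguerreCell_subset p φ i) (fun _ => (1 : ℝ))
  simpa [cellMass] using h.symm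

theorem barycenter_eq (hΩ : IsCompact Ω) {t : ℝ} (ht : 0 ≤ t) (p : Config N d) (φ : Dual N)
    (i : Fin N) :
    barycenter Ω ρ p φ t i = ((targetMeasure Ω ρ t).real (laguerreCell Ω p φ i))⁻¹ •
      ∫ x in laguerreCell Ω p φ i, x ∂(targetMeasure Ω ρ t) := by
  rw [barycenter, hρ.cellMass_eq hΩ ht, hρ.setIntegral_targetMeasure hΩ ht
    (measurableSet_laguerreCell hΩ p φ i) (laguerreCell_subset p φ i)]

/-- For a massless cell both sides are zero, whatever default value the barycenter takes, so the
gradient formula needs no case distinction. -/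
theorem cellMass_smul_sub_barycenter (hΩ : IsCompact Ω) {t : ℝ} (ht : 0 ≤ t) (p : Config N d)
    (φ : Dual N) (i : Fin N) :
    cellMass Ω ρ p φ t i • (p i - barycenter Ω ρ p φ t i)
      = (targetMeasure Ω ρ t).real (laguerreCell Ω p φ i) • p i
        - ∫ x in laguerreCell Ω p φ i, x ∂(targetMeasure Ω ρ t) := by
  have := (hρ.isHyperplaneNull_targetMeasure hΩ ht).isProbabilityMeasure
  rw [hρ.cellMass_eq hΩ ht, hρ.barycenter_eq hΩ ht, smul_sub]
  congr 1
  by_cases h0 : (targetMeasure Ω ρ t).real (laguerreCell Ω p φ i) = 0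
  · rw [h0, zero_smul, setIntegral_measure_zero]
    exact (measureReal_eq_zero_iff (measure_ne_top _ _)).1 h0
  · rw [smul_smul, mul_inv_cancel₀ h0, one_smul]

theorem cellMass_le_one (hΩ : IsCompact Ω) {t : ℝ} (ht : 0 ≤ t) (p : Config N d) (φ : Dual N)
    (i : Fin N) : cellMass Ω ρ p φ t i ≤ 1 := by
  have := (hρ.isHyperplaneNull_targetMeasure hΩ ht).isProbabilityMeasure
  rw [hρ.cellMass_eq hΩ ht]
  exact measureReal_le_one

/-- Distinctness is needed, since coincident agents can share a cell that the sum counts twice. It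
is an open condition, so derivatives still transfer. -/
theorem dualObjective_eq [Nonempty (Fin N)] (hΩ : IsCompact Ω) {t : ℝ} (ht : 0 ≤ t)
    {p : Config N d} (hp : Function.Injective p) (φ : Dual N) :
    dualObjective Ω ρ p φ t = kantorovich (targetMeasure Ω ρ t) (p, φ) := by
  rw [(hρ.isHyperplaneNull_targetMeasure hΩ ht).kantorovich_eq (z := (p, φ)) hp]
  refine Finset.sum_congr rfl fun i _ => ?_
  rw [← hρ.cellMass_eq hΩ ht, hρ.setIntegral_targetMeasure hΩ ht
    (measurableSet_laguerreCell hΩ p φ i) (laguerreCell_subset p φ i), cellMass]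
  simp only [smul_eq_mul, mul_comm]

theorem hasFDerivAt_dualObjective [Nonempty (Fin N)] (hΩ : IsCompact Ω) {t : ℝ} (ht : 0 ≤ t)
    {p : Config N d} (hp : Function.Injective p) (φ : Dual N) :
    HasFDerivAt (fun z : Config N d × Dual N => dualObjective Ω ρ z.1 z.2 t)
      (kantorovichDeriv Ω (targetMeasure Ω ρ t) (p, φ)) (p, φ) := by
  refine ((hρ.isHyperplaneNull_targetMeasure hΩ ht).hasFDerivAt_kantorovich
    (z := (p, φ)) hp).congr_of_eventuallyEq ?_
  filter_upwards [eventually_injective (z := (p, φ)) hp] with w hw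
  exact hρ.dualObjective_eq hΩ ht hw w.2

theorem contDiffAt_dualObjective [Nonempty (Fin N)] (hΩ : IsCompact Ω) {t : ℝ} (ht : 0 ≤ t)
    {p : Config N d} (hp : Function.Injective p) (φ : Dual N) :
    ContDiffAt ℝ 1 (fun z : Config N d × Dual N => dualObjective Ω ρ z.1 z.2 t) (p, φ) := by
  refine ((hρ.isHyperplaneNull_targetMeasure hΩ ht).contDiffAt_kantorovich
    (z := (p, φ)) hp).congr_of_eventuallyEq ?_
  filter_upwards [eventually_injective (z := (p, φ)) hp] with w hw
  exact hρ.dualObjective_eq hΩ ht hw w.2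

theorem kantorovichDeriv_targetMeasure (hΩ : IsCompact Ω) {t : ℝ} (ht : 0 ≤ t)
    (p : Config N d) (φ : Dual N) (v : Config N d × Dual N) :
    kantorovichDeriv Ω (targetMeasure Ω ρ t) (p, φ) v
      = ∑ i, (inner ℝ (cellMass Ω ρ p φ t i • (p i - barycenter Ω ρ p φ t i)) (v.1 i)
        + (1 / (N : ℝ) - cellMass Ω ρ p φ t i) * v.2 i) := by
  simp only [kantorovichDeriv_apply, hρ.cellMass_smul_sub_barycenter hΩ ht]
  simp only [hρ.cellMass_eq hΩ ht]

theorem hasGradientAt_dualObjective [Nonempty (Fin N)] (hΩ : IsCompact Ω) {t : ℝ} (ht : 0 ≤ t)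
    {p : Config N d} (hp : Function.Injective p) (φ : Dual N) (i : Fin N) :
    HasGradientAt (fun y => dualObjective Ω ρ (Function.update p i y) φ t)
      (cellMass Ω ρ p φ t i • (p i - barycenter Ω ρ p φ t i)) (p i) := by
  have h1 := hρ.hasFDerivAt_dualObjective hΩ ht hp φ
  have h2 : HasFDerivAt (fun y => (Function.update p i y, φ))
      ((ContinuousLinearMap.inl ℝ (Config N d) (Dual N)).comp
        (ContinuousLinearMap.pi (Pi.single i (ContinuousLinearMap.id ℝ (Space d))))) (p i) :=
    HasFDerivAt.comp (g := fun q : Config N d => (q, φ)) (p i) (hasFDerivAt_prodMk_left _ φ)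
      (hasFDerivAt_update p (p i))
  rw [← Function.update_eq_self i p] at h1
  rw [hasGradientAt_iff_hasFDerivAt]
  have h3 := HasFDerivAt.comp
    (g := fun z : Config N d × Dual N => dualObjective Ω ρ z.1 z.2 t) (p i) h1 h2
  refine h3.congr_fderiv (ContinuousLinearMap.ext fun v => ?_)
  rw [Function.update_eq_self, ContinuousLinearMap.comp_apply,
    hρ.kantorovichDeriv_targetMeasure hΩ ht, Finset.sum_eq_single i]
  · simp [real_inner_smul_left, inner_sub_left]
  · intro j _ hj
    simp [hj]
  · simp

theorem hasDerivAt_dualObjective [Nonempty (Fin N)] (hΩ : IsCompact Ω) {t : ℝ} (ht : 0 ≤ t)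
    {p : Config N d} (hp : Function.Injective p) (φ : Dual N) (i : Fin N) :
    HasDerivAt (fun y => dualObjective Ω ρ p (Function.update φ i y) t)
      (1 / (N : ℝ) - cellMass Ω ρ p φ t i) (φ i) := by
  have h1 := hρ.hasFDerivAt_dualObjective hΩ ht hp φ
  have h2 : HasDerivAt (fun y => (p, Function.update φ i y))
      ((0, Pi.single i 1) : Config N d × Dual N) (φ i) :=
    (hasDerivAt_const _ p).prodMk (hasDerivAt_update φ i (φ i))
  rw [← Function.update_eq_self i φ] at h1
  have h3 := HasFDerivAt.comp_hasDerivAt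
    (l := fun z : Config N d × Dual N => dualObjective Ω ρ z.1 z.2 t) (φ i) h1 h2
  refine h3.congr_deriv ?_
  rw [Function.update_eq_self, hρ.kantorovichDeriv_targetMeasure hΩ ht, Finset.sum_eq_single i]
  · simp
  · intro j _ hj
    simp [hj]
  · simp

theorem fderiv_dualObjective_eq_zero_iff [Nonempty (Fin N)] (hΩ : IsCompact Ω) {t : ℝ}
    (ht : 0 ≤ t) {p : Config N d} (hp : Function.Injective p) (φ : Dual N) :
    fderiv ℝ (fun z : Config N d × Dual N => dualObjective Ω ρ z.1 z.2 t) (p, φ) = 0 ↔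
      IsCentroidalEqualMass Ω ρ p φ t := by
  have hNpos : (0 : ℝ) < N := by exact_mod_cast Fin.pos_iff_nonempty.2 ‹Nonempty (Fin N)›
  rw [(hρ.hasFDerivAt_dualObjective hΩ ht hp φ).fderiv]
  have happ := hρ.kantorovichDeriv_targetMeasure hΩ ht p φ
  constructor
  · intro h i
    have hm : cellMass Ω ρ p φ t i = 1 / (N : ℝ) := by
      have h1 := happ (0, Pi.single i 1)
      rw [h, Finset.sum_eq_single i] at h1
      · simp at h1 ⊢; linarith
      · intro j _ hj
        simp [hj]
      · simp
    refine ⟨?_, hm⟩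
    -- Testing in the direction of the residual itself leaves `1/N` times its squared norm.
    have h1 := happ (Pi.single i (p i - barycenter Ω ρ p φ t i), 0)
    rw [h, Finset.sum_eq_single i, hm] at h1
    · simp only [zero_apply, Pi.single_eq_same, real_inner_smul_left, real_inner_self_eq_norm_sq,
        Pi.zero_apply, mul_zero, add_zero] at h1
      have h2 : ‖p i - barycenter Ω ρ p φ t i‖ ^ 2 = 0 :=
        (mul_eq_zero.1 h1.symm).resolve_left (by positivity)
      exact sub_eq_zero.1 (norm_eq_zero.1 (pow_eq_zero_iff two_ne_zero |>.1 h2))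
    · intro j _ hj
      simp [hj]
    · simp
  · intro h
    refine ContinuousLinearMap.ext fun v => ?_
    rw [happ]
    refine Finset.sum_eq_zero fun i _ => ?_
    rw [(h i).2, ← (h i).1]
    simp

end IsTargetDensity

end SemiDiscreteOT

end

noncomputable section

/-! ### Calculus of absolutely continuous curves. -/

section AbsolutelyContinuous

variable {X Y : Type*} [PseudoMetricSpace X] [PseudoMetricSpace Y] {a b : ℝ}

open AbsolutelyContinuousOnInterval in
-- Increments controlled by those of an absolutely continuous curve have small sums whenever the
-- latter do. This converts Lipschitz dependence on `(p, φ, t)` into absolute continuity in time.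
theorem AbsolutelyContinuousOnInterval.of_dist_le {f : ℝ → X} {g : ℝ → Y} {C : ℝ}
    (hg : AbsolutelyContinuousOnInterval g a b)
    (h : ∀ x ∈ uIcc a b, ∀ y ∈ uIcc a b, dist (f x) (f y) ≤ C * dist (g x) (g y)) :
    AbsolutelyContinuousOnInterval f a b := by
  have h0 : Tendsto (fun E : ℕ × (ℕ → ℝ × ℝ) =>
      C * ∑ i ∈ Finset.range E.1, dist (g (E.2 i).1) (g (E.2 i).2))
      (totalLengthFilter ⊓ 𝓟 (disjWithin a b)) (𝓝 0) := by
    simpa using Tendsto.const_mul C hg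
  refine squeeze_zero' (Eventually.of_forall fun E => Finset.sum_nonneg fun i _ => dist_nonneg)
    ?_ h0
  filter_upwards [mem_inf_of_right (mem_principal_self _)] with E hE
  rw [Finset.mul_sum]
  exact Finset.sum_le_sum fun i hi => h _ (hE.1 i hi).1 _ (hE.1 i hi).2

theorem AbsolutelyContinuousOnInterval.prodMk {f : ℝ → X} {g : ℝ → Y}
    (hf : AbsolutelyContinuousOnInterval f a b) (hg : AbsolutelyContinuousOnInterval g a b) :
    AbsolutelyContinuousOnInterval (fun t => (f t, g t)) a b := by
  refine squeeze_zero (fun E => Finset.sum_nonneg fun i _ => dist_nonneg) (fun E => ?_)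
    (by simpa using Tendsto.add hf hg)
  rw [← Finset.sum_add_distrib]
  refine Finset.sum_le_sum fun i _ => ?_
  rw [Prod.dist_eq]
  exact max_le (le_add_of_nonneg_right dist_nonneg) (le_add_of_nonneg_left dist_nonneg)

theorem AbsolutelyContinuousOnInterval.pi {ι : Type*} [Fintype ι] {f : ℝ → ι → X}
    (hf : ∀ i, AbsolutelyContinuousOnInterval (fun t => f t i) a b) :
    AbsolutelyContinuousOnInterval f a b := by
  refine squeeze_zero (fun E => Finset.sum_nonneg fun i _ => dist_nonneg) (fun E => ?_)
    (by simpa using tendsto_finsetSum Finset.univ fun i _ => hf i)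
  rw [Finset.sum_comm]
  refine Finset.sum_le_sum fun k _ => ?_
  rw [dist_pi_le_iff (Finset.sum_nonneg fun i _ => dist_nonneg)]
  exact fun i => Finset.single_le_sum
    (f := fun i => dist (f (E.2 k).1 i) (f (E.2 k).2 i)) (fun _ _ => dist_nonneg)
    (Finset.mem_univ i)

theorem AbsolutelyContinuousOnInterval.eval {ι : Type*} [Fintype ι] {f : ℝ → ι → X}
    (hf : AbsolutelyContinuousOnInterval f a b) (i : ι) :
    AbsolutelyContinuousOnInterval (fun t => f t i) a b :=
  AbsolutelyContinuousOnInterval.of_dist_le (C := 1) hf fun x _ y _ => by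
    simpa using dist_le_pi_dist (f x) (f y) i

theorem absolutelyContinuousOnInterval_id : AbsolutelyContinuousOnInterval (fun t : ℝ => t) a b :=
  (LipschitzWith.id.lipschitzOnWith (s := uIcc a b)).absolutelyContinuousOnInterval

theorem AbsolutelyContinuousOnInterval.inv_of_pos {f : ℝ → ℝ}
    (hf : AbsolutelyContinuousOnInterval f a b) (hpos : ∀ x ∈ uIcc a b, 0 < f x) :
    AbsolutelyContinuousOnInterval (fun t => (f t)⁻¹) a b := by
  obtain ⟨α, hα, hle⟩ := isCompact_uIcc.exists_forall_le' hf.continuousOn hpos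
  refine AbsolutelyContinuousOnInterval.of_dist_le (C := (α * α)⁻¹) hf fun x hx y hy => ?_
  have hx0 := hpos x hx
  have hy0 := hpos y hy
  rw [Real.dist_eq, Real.dist_eq, inv_sub_inv hx0.ne' hy0.ne', abs_div, abs_sub_comm,
    abs_of_pos (mul_pos hx0 hy0), div_eq_inv_mul]
  refine mul_le_mul_of_nonneg_right ?_ (abs_nonneg _)
  exact inv_anti₀ (mul_pos hα hα) (mul_le_mul (hle x hx) (hle y hy) hα.le hx0.le)

theorem AbsolutelyContinuousOnInterval.norm_sq {E : Type*} [NormedAddCommGroup E] {f : ℝ → E}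
    (hf : AbsolutelyContinuousOnInterval f a b) :
    AbsolutelyContinuousOnInterval (fun t => ‖f t‖ ^ 2) a b := by
  have h : AbsolutelyContinuousOnInterval (fun t => ‖f t‖) a b :=
    AbsolutelyContinuousOnInterval.of_dist_le (C := 1) hf fun x _ y _ => by
      simpa [Real.dist_eq, dist_eq_norm] using abs_norm_sub_norm_le (f x) (f y)
  simpa only [sq] using! h.mul h

theorem AbsolutelyContinuousOnInterval.finsetSum {ι E : Type*} [NormedAddCommGroup E]
    (s : Finset ι) {f : ι → ℝ → E} (hf : ∀ i ∈ s, AbsolutelyContinuousOnInterval (f i) a b) :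
    AbsolutelyContinuousOnInterval (fun t => ∑ i ∈ s, f i t) a b := by
  classical
  induction s using Finset.induction_on with
  | empty =>
    simpa using (LipschitzWith.const (0 : E)).lipschitzOnWith (s := uIcc a b)
      |>.absolutelyContinuousOnInterval
  | insert i s hi ih =>
    simp only [Finset.sum_insert hi]
    exact (hf i (Finset.mem_insert_self i s)).add
      (ih fun j hj => hf j (Finset.mem_insert_of_mem hj))

/-- A function which is absolutely continuous on the compact subintervals of an interval is
differentiable almost everywhere on it. -/
theorem Set.OrdConnected.ae_differentiableAt {E : Type*} [NormedAddCommGroup E] [NormedSpace ℝ E]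
    [FiniteDimensional ℝ E] {J : Set ℝ} (hJ : J.OrdConnected) {f : ℝ → E}
    (hf : ∀ s ∈ J, ∀ t ∈ J, AbsolutelyContinuousOnInterval f s t) :
    ∀ᵐ t : ℝ, t ∈ J → DifferentiableAt ℝ f t := by
  have hbv : LocallyBoundedVariationOn f J := fun s t hs ht =>
    (hf s hs t ht).boundedVariationOn.mono (inter_subset_right.trans Icc_subset_uIcc)
  -- Bounded variation only gives derivatives within `J`; at interior points these are two-sided,
  -- and the endpoints are null.
  have hfr : volume (frontier J) = 0 := hJ.convex.addHaar_frontier volume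
  have hfr' : ∀ᵐ t : ℝ, t ∉ frontier J := by rw [ae_iff]; simpa using! hfr
  filter_upwards [hbv.ae_differentiableWithinAt_of_mem, hfr'] with t h1 h2 ht
  refine (h1 ht).differentiableAt (mem_interior_iff_mem_nhds.1 ?_)
  by_contra h3
  exact h2 ⟨subset_closure ht, h3⟩

end AbsolutelyContinuous

/-! ### Absolute continuity of masses and barycenters. -/

namespace SemiDiscreteOT

variable {d N : ℕ} {Ω : Set (Space d)}

/-- Separates the change of domain, paid for by the symmetric difference, from the change of
integrand. -/
theorem norm_setIntegral_sub_setIntegral_le {F : Type*} [NormedAddCommGroup F] [NormedSpace ℝ F]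
    (hΩ : IsCompact Ω) {f g : Space d → F} (hf : IntegrableOn f Ω) (hg : IntegrableOn g Ω)
    {A B : Set (Space d)} (hA : MeasurableSet A) (hB : MeasurableSet B) (hAΩ : A ⊆ Ω)
    (hBΩ : B ⊆ Ω) {M ε : ℝ} (hε : 0 ≤ ε) (hM : ∀ x ∈ Ω, ‖f x‖ ≤ M)
    (hfg : ∀ x ∈ Ω, ‖f x - g x‖ ≤ ε) :
    ‖(∫ x in A, f x) - ∫ x in B, g x‖
      ≤ M * (volume.real (A \ B) + volume.real (B \ A)) + ε * volume.real Ω := by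
  have hfin : ∀ S ⊆ Ω, volume S < ⊤ := fun S hS =>
    (measure_mono hS).trans_lt hΩ.measure_lt_top
  have h1 := integral_inter_add_sdiff hB (hf.mono_set hAΩ)
  have h2 := integral_inter_add_sdiff hA (hf.mono_set hBΩ)
  rw [inter_comm] at h2
  have h3 : (∫ x in A, f x) - ∫ x in B, g x
      = ((∫ x in A \ B, f x) - ∫ x in B \ A, f x) + ∫ x in B, (f x - g x) := by
    rw [integral_sub (hf.mono_set hBΩ) (hg.mono_set hBΩ), ← h1, ← h2]
    abel
  have h4 : ‖∫ x in A \ B, f x‖ ≤ M * volume.real (A \ B) :=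
    norm_setIntegral_le_of_norm_le_const (hfin _ (sdiff_subset.trans hAΩ))
      fun x hx => hM x (hAΩ hx.1)
  have h5 : ‖∫ x in B \ A, f x‖ ≤ M * volume.real (B \ A) :=
    norm_setIntegral_le_of_norm_le_const (hfin _ (sdiff_subset.trans hBΩ))
      fun x hx => hM x (hBΩ hx.1)
  have h6 : ‖∫ x in B, (f x - g x)‖ ≤ ε * volume.real Ω :=
    (norm_setIntegral_le_of_norm_le_const (hfin _ hBΩ) fun x hx => hfg x (hBΩ hx)).trans
      (mul_le_mul_of_nonneg_left (measureReal_mono hBΩ hΩ.measure_lt_top.ne) hε)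
  rw [h3]
  refine (norm_add_le _ _).trans ?_
  have h7 := norm_sub_le (∫ x in A \ B, f x) (∫ x in B \ A, f x)
  linarith

/-- A point that leaves cell `i` is overtaken by some `j`. Each of the two costs moves by at most
`c`, so the point lies in a slab of thickness `2 * c` measured by `inner ℝ (p_i - p_j) x`, hence of
width at most `2 * c / δ`. -/
theorem volume_real_laguerreCell_sdiff_le {R δ : ℝ} (hδ : 0 < δ) (hR : ∀ x ∈ Ω, ‖x‖ ≤ R)
    {z w : Config N d × Dual N} (hz : ‖z‖ ≤ R) (hw : ‖w‖ ≤ R)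
    (hsep : ∀ i j, i ≠ j → δ ≤ ‖z.1 i - z.1 j‖) (i : Fin N) :
    volume.real (laguerreCell Ω z.1 z.2 i \ laguerreCell Ω w.1 w.2 i)
      ≤ N * (2 * (2 * R + 1) / δ * volume.real (Metric.closedBall (0 : Space d) (R + 2)))
        * ‖z - w‖ := by
  have hR0 : 0 ≤ R := (norm_nonneg z).trans hz
  set B := volume.real (Metric.closedBall (0 : Space d) (R + 2)) with hB
  set c := (2 * R + 1) * ‖z - w‖ with hc
  have hc0 : 0 ≤ c := by positivity
  set S : Fin N → Set (Space d) := fun j => if i = j then ∅ else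
    {x | ‖x‖ ≤ R ∧ separatingLevel z i j ≤ inner ℝ (z.1 i - z.1 j) x ∧
      inner ℝ (z.1 i - z.1 j) x < separatingLevel z i j + 2 * c} with hS
  have hsub : laguerreCell Ω z.1 z.2 i \ laguerreCell Ω w.1 w.2 i ⊆ ⋃ j, S j := by
    rintro x ⟨hxz, hxw⟩
    have h1 : ∃ j, powerCost w j x < powerCost w i x := by
      by_contra hcon
      push Not at hcon
      exact hxw ⟨hxz.1, hcon⟩
    obtain ⟨j, hj⟩ := h1
    have hij : i ≠ j := by rintro rfl; exact lt_irrefl _ hj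
    refine mem_iUnion.2 ⟨j, ?_⟩
    simp only [hS, if_neg hij]
    have h2 := powerCost_sub_powerCost z i j x
    have h3 : powerCost z i x ≤ powerCost z j x := hxz.2 j
    have h4 := abs_le.1 (abs_powerCost_sub_le hz hw (hR x hxz.1) i)
    have h5 := abs_le.1 (abs_powerCost_sub_le hz hw (hR x hxz.1) j)
    exact ⟨hR x hxz.1, by linarith, by linarith [h4.1, h5.2]⟩
  have hSle : ∀ j, volume.real (S j) ≤ 2 * c / δ * B := fun j => by
    by_cases hij : i = j
    · simp only [hS, if_pos hij, measureReal_empty]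
      positivity
    · simp only [hS, if_neg hij]
      have hd := hsep i j hij
      refine (volume_real_slab_le (norm_pos_iff.1 (hδ.trans_le hd)) _ (by positivity)).trans ?_
      refine mul_le_mul_of_nonneg_right ?_ measureReal_nonneg
      exact div_le_div_of_nonneg_left (by positivity) hδ hd
  have hSfin : volume (⋃ j, S j) ≠ ⊤ := by
    refine ((measure_mono (iUnion_subset fun j x hx => ?_)).trans_lt
      (measure_closedBall_lt_top (x := (0 : Space d)) (r := R))).ne
    by_cases hij : i = j
    · simp [hS, hij] at hx
    · simp only [hS, if_neg hij] at hx
      exact mem_closedBall_zero_iff.2 hx.1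
  calc volume.real (laguerreCell Ω z.1 z.2 i \ laguerreCell Ω w.1 w.2 i)
      ≤ volume.real (⋃ j, S j) := measureReal_mono hsub hSfin
    _ ≤ ∑ j, volume.real (S j) := measureReal_iUnion_fintype_le S
    _ ≤ ∑ _j : Fin N, 2 * c / δ * B := Finset.sum_le_sum fun j _ => hSle j
    _ = _ := by
      rw [Finset.sum_const, Finset.card_univ, Fintype.card_fin, nsmul_eq_mul, hc]
      ring

/-- Integrals over the Laguerre cells are absolutely continuous along absolutely continuous
trajectories without overlaps. -/
theorem absolutelyContinuousOnInterval_setIntegral_laguerreCell {F : Type*}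
    [NormedAddCommGroup F] [NormedSpace ℝ F] (hΩ : IsCompact Ω) {f : Space d → ℝ → F} {a b : ℝ}
    {M L : ℝ} (hf : ∀ t ∈ uIcc a b, ContinuousOn (fun x => f x t) Ω)
    (hM : ∀ x ∈ Ω, ∀ t ∈ uIcc a b, ‖f x t‖ ≤ M)
    (hL : ∀ x ∈ Ω, ∀ s ∈ uIcc a b, ∀ t ∈ uIcc a b, ‖f x s - f x t‖ ≤ L * |s - t|)
    {z : ℝ → Config N d × Dual N} (hz : AbsolutelyContinuousOnInterval z a b)
    (hinj : ∀ t ∈ uIcc a b, Function.Injective (z t).1) (i : Fin N) :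
    AbsolutelyContinuousOnInterval (fun t => ∫ x in laguerreCell Ω (z t).1 (z t).2 i, f x t)
      a b := by
  obtain ⟨R₁, hR₁⟩ := hΩ.isBounded.exists_norm_le
  obtain ⟨R₂, hR₂⟩ := hz.exists_bound
  set R := max R₁ R₂ with hR
  have hcomp : ∀ x ∈ Ω, ‖x‖ ≤ R := fun x hx => (hR₁ x hx).trans (le_max_left _ _)
  have htraj : ∀ t ∈ uIcc a b, ‖z t‖ ≤ R := fun t ht => (hR₂ t ht).trans (le_max_right _ _)
  -- On a compact time interval continuity makes the pairwise distances uniformly positive; a small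
  -- `η` serves all the finitely many pairs.
  obtain ⟨δ, hδ, hsep⟩ : ∃ δ : ℝ, 0 < δ ∧ ∀ t ∈ uIcc a b, ∀ i j, i ≠ j →
      δ ≤ ‖(z t).1 i - (z t).1 j‖ := by
    have h1 : ∀ k : Fin N × Fin N, ∃ δ : ℝ, 0 < δ ∧ ∀ t ∈ uIcc a b, k.1 ≠ k.2 →
        δ ≤ ‖(z t).1 k.1 - (z t).1 k.2‖ := fun k => by
      by_cases hk : k.1 = k.2
      · exact ⟨1, one_pos, fun t _ h => absurd hk h⟩
      have hc : ContinuousOn (fun t => ‖(z t).1 k.1 - (z t).1 k.2‖) (uIcc a b) :=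
        Continuous.comp_continuousOn
          (g := fun y : Config N d × Dual N => ‖y.1 k.1 - y.1 k.2‖) (by fun_prop) hz.continuousOn
      obtain ⟨δ, hδ, h⟩ := isCompact_uIcc.exists_forall_le' hc (a := 0) fun t ht =>
        norm_pos_iff.2 (sub_ne_zero.2 ((hinj t ht).ne hk))
      exact ⟨δ, hδ, fun t ht _ => h t ht⟩
    choose δ hδ h using h1
    have h2 : ∀ᶠ η in 𝓝[>] (0 : ℝ), ∀ k, η ≤ δ k := eventually_all.2 fun k => by
      filter_upwards [Ioc_mem_nhdsGT (hδ k)] with η hη using hη.2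
    obtain ⟨η, hη, hη0⟩ := (h2.and self_mem_nhdsWithin).exists
    exact ⟨η, hη0, fun t ht i j hij => (hη (i, j)).trans (h (i, j) t ht hij)⟩
  set κ := N * (2 * (2 * R + 1) / δ * volume.real (Metric.closedBall (0 : Space d) (R + 2)))
    with hκ
  refine AbsolutelyContinuousOnInterval.of_dist_le
    (C := |M| * (2 * κ) + |L| * volume.real Ω)
    (hz.prodMk absolutelyContinuousOnInterval_id) fun s hs t ht => ?_
  have hint : ∀ t ∈ uIcc a b, IntegrableOn (fun x => f x t) Ω := fun t ht =>
    (hf t ht).integrableOn_compact hΩ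
  have h1 := norm_setIntegral_sub_setIntegral_le hΩ (hint s hs) (hint t ht)
    (measurableSet_laguerreCell hΩ (z s).1 (z s).2 i)
    (measurableSet_laguerreCell hΩ (z t).1 (z t).2 i)
    (laguerreCell_subset _ _ i) (laguerreCell_subset _ _ i)
    (by positivity : 0 ≤ |L| * |s - t|) (fun x hx => (hM x hx s hs).trans (le_abs_self M))
    (fun x hx => (hL x hx s hs t ht).trans
      (mul_le_mul_of_nonneg_right (le_abs_self L) (abs_nonneg _)))
  have h2 := volume_real_laguerreCell_sdiff_le hδ hcomp (htraj s hs) (htraj t ht)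
    (hsep s hs) i
  have h3 := volume_real_laguerreCell_sdiff_le hδ hcomp (htraj t ht) (htraj s hs)
    (hsep t ht) i
  rw [norm_sub_rev] at h3
  set D := dist (z s, s) (z t, t) with hD
  have hκ0 : 0 ≤ κ := by
    have : 0 ≤ R := (norm_nonneg _).trans (htraj s hs)
    positivity
  have h4 : ‖z s - z t‖ ≤ D := by
    rw [← dist_eq_norm, hD, Prod.dist_eq]; exact le_max_left _ _
  have h5 : |s - t| ≤ D := by
    rw [← Real.dist_eq, hD, Prod.dist_eq]; exact le_max_right _ _
  rw [dist_eq_norm]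
  refine h1.trans ?_
  have h6 := mul_le_mul_of_nonneg_left h4 hκ0
  have h7 := mul_le_mul_of_nonneg_left (add_le_add (h2.trans h6) (h3.trans h6)) (abs_nonneg M)
  have h8 := mul_le_mul_of_nonneg_right (mul_le_mul_of_nonneg_left h5 (abs_nonneg L))
    (measureReal_nonneg (μ := volume) (s := Ω))
  linarith

namespace IsTargetDensity

variable {ρ : Space d → ℝ → ℝ} (hρ : IsTargetDensity Ω ρ)
include hρ

theorem exists_abs_le (hΩ : IsCompact Ω) {a b : ℝ} (hab : uIcc a b ⊆ Ici 0) :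
    ∃ M, ∀ x ∈ Ω, ∀ t ∈ uIcc a b, |ρ x t| ≤ M := by
  obtain ⟨M, hM⟩ := (hΩ.prod (isCompact_uIcc (a := a) (b := b))).exists_bound_of_continuousOn
    (hρ.contDiffOn.continuousOn.mono (prod_mono_right hab))
  exact ⟨M, fun x hx t ht => hM (x, t) ⟨hx, ht⟩⟩

theorem absolutelyContinuousOnInterval_cellMass (hΩ : IsCompact Ω) {a b : ℝ}
    (hab : uIcc a b ⊆ Ici 0) {z : ℝ → Config N d × Dual N}
    (hz : AbsolutelyContinuousOnInterval z a b)
    (hinj : ∀ t ∈ uIcc a b, Function.Injective (z t).1) (i : Fin N) :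
    AbsolutelyContinuousOnInterval (fun t => cellMass Ω ρ (z t).1 (z t).2 t i) a b := by
  obtain ⟨M, hM⟩ := hρ.exists_abs_le hΩ hab
  obtain ⟨L, hL⟩ := hρ.lipschitz
  exact absolutelyContinuousOnInterval_setIntegral_laguerreCell hΩ
    (fun t ht => hρ.continuousOn (hab ht)) hM
    (fun x hx s hs t ht => hL x hx s t (hab hs) (hab ht)) hz hinj i

theorem absolutelyContinuousOnInterval_barycenter (hΩ : IsCompact Ω) {a b : ℝ}
    (hab : uIcc a b ⊆ Ici 0) {z : ℝ → Config N d × Dual N}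
    (hz : AbsolutelyContinuousOnInterval z a b)
    (hinj : ∀ t ∈ uIcc a b, Function.Injective (z t).1)
    (hpos : ∀ t ∈ uIcc a b, ∀ i, 0 < cellMass Ω ρ (z t).1 (z t).2 t i) :
    AbsolutelyContinuousOnInterval (fun t => barycenter Ω ρ (z t).1 (z t).2 t) a b := by
  obtain ⟨M, hM⟩ := hρ.exists_abs_le hΩ hab
  obtain ⟨L, hL⟩ := hρ.lipschitz
  obtain ⟨R, hR⟩ := hΩ.isBounded.exists_norm_le
  refine AbsolutelyContinuousOnInterval.pi fun i => ?_
  refine ((hρ.absolutelyContinuousOnInterval_cellMass hΩ hab hz hinj i).inv_of_pos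
    fun t ht => hpos t ht i).smul (absolutelyContinuousOnInterval_setIntegral_laguerreCell hΩ
    (f := fun x t => ρ x t • x) (M := M * R) (L := L * R)
    (fun t ht => (hρ.continuousOn (hab ht)).smul continuousOn_id) ?_ ?_ hz hinj i)
  · intro x hx t ht
    rw [norm_smul]
    exact mul_le_mul (hM x hx t ht) (hR x hx) (norm_nonneg _)
      ((abs_nonneg _).trans (hM x hx t ht))
  · intro x hx s hs t ht
    rw [← sub_smul, norm_smul, mul_right_comm]
    have h := hL x hx s t (hab hs) (hab ht)
    exact mul_le_mul h (hR x hx) (norm_nonneg _) ((abs_nonneg _).trans h)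

end IsTargetDensity

/-! ### The saddle-point statements. -/

variable {ρ : Space d → ℝ → ℝ}

namespace IsTargetDensity

section SaddlePoint

variable [Nonempty (Fin N)] (hρ : IsTargetDensity Ω ρ) (hΩ : IsCompact Ω) {t : ℝ} (ht : 0 ≤ t)
  {p : Config N d} (hp : Function.Injective p)
include hρ hΩ ht hp

theorem forall_dualObjective_le_iff (φ : Dual N) :
    (∀ ψ : Dual N, dualObjective Ω ρ p ψ t ≤ dualObjective Ω ρ p φ t) ↔
      ∀ i, cellMass Ω ρ p φ t i = 1 / (N : ℝ) := by
  simp only [hρ.dualObjective_eq hΩ ht hp, hρ.cellMass_eq hΩ ht]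
  exact (hρ.isHyperplaneNull_targetMeasure hΩ ht).forall_kantorovich_le_iff hp φ

theorem toReal_transportCost {φ : Dual N} (hφ : ∀ i, cellMass Ω ρ p φ t i = 1 / (N : ℝ)) :
    (transportCost Ω ρ p t).toReal = dualObjective Ω ρ p φ t := by
  rw [hρ.dualObjective_eq hΩ ht hp]
  simp only [hρ.cellMass_eq hΩ ht] at hφ
  exact (hρ.isHyperplaneNull_targetMeasure hΩ ht).toReal_wassersteinSq hp hφ

theorem transportCost_ne_top : transportCost Ω ρ p t ≠ ⊤ :=
  (hρ.isHyperplaneNull_targetMeasure hΩ ht).wassersteinSq_ne_top hp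

theorem exists_equal_mass : ∃ φ : Dual N, ∀ i, cellMass Ω ρ p φ t i = 1 / (N : ℝ) := by
  simp only [hρ.cellMass_eq hΩ ht]
  exact (hρ.isHyperplaneNull_targetMeasure hΩ ht).exists_equal_mass hp

theorem isGreatest_transportCost :
    IsGreatest (range fun φ : Dual N => dualObjective Ω ρ p φ t)
      (transportCost Ω ρ p t).toReal := by
  obtain ⟨φ, hφ⟩ := hρ.exists_equal_mass hΩ ht hp
  rw [hρ.toReal_transportCost hΩ ht hp hφ]
  refine ⟨⟨φ, rfl⟩, ?_⟩
  rintro _ ⟨ψ, rfl⟩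
  exact (hρ.forall_dualObjective_le_iff hΩ ht hp φ).2 hφ ψ

theorem concaveOn_dualObjective :
    ConcaveOn ℝ univ fun φ : Dual N => dualObjective Ω ρ p φ t := by
  simp only [hρ.dualObjective_eq hΩ ht hp]
  exact (hρ.isHyperplaneNull_targetMeasure hΩ ht).concaveOn_kantorovich hp

theorem tendsto_of_dual_law {Kφ : ℝ} (hKφ : 0 < Kφ) {ψ : ℝ → Dual N}
    (hψ : ∀ s, 0 ≤ s → ∀ i, HasDerivWithinAt (fun r => ψ r i)
      (Kφ * (1 / (N : ℝ) - cellMass Ω ρ p (ψ s) t i)) (Ici 0) s) :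
    (∀ i, Tendsto (fun s => cellMass Ω ρ p (ψ s) t i) atTop (𝓝 (1 / (N : ℝ)))) ∧
      Tendsto (fun s => dualObjective Ω ρ p (ψ s) t) atTop
        (𝓝 (transportCost Ω ρ p t).toReal) := by
  have hν := hρ.isHyperplaneNull_targetMeasure hΩ ht
  obtain ⟨φ, hφ⟩ := hρ.exists_equal_mass hΩ ht hp
  have hmax := (hρ.forall_dualObjective_le_iff hΩ ht hp φ).2 hφ
  rw [hρ.toReal_transportCost hΩ ht hp hφ]
  simp only [hρ.dualObjective_eq hΩ ht hp, hρ.cellMass_eq hΩ ht] at hψ hmax ⊢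
  obtain ⟨h1, R, hR⟩ := hν.tendsto_kantorovich_of_gradient_flow hp hKφ hmax hψ
  exact ⟨hν.tendsto_mass_of_tendsto_kantorovich hp hmax h1 hR, h1⟩

theorem isCentroidalEqualMass_of_isLocalMinOn (hconv : Convex ℝ Ω) (hpΩ : ∀ i, p i ∈ Ω)
    (hmin : IsLocalMinOn (fun q : Config N d => transportCost Ω ρ q t) {q | ∀ i, q i ∈ Ω} p)
    {φ : Dual N} (hφ : ∀ ψ : Dual N, dualObjective Ω ρ p ψ t ≤ dualObjective Ω ρ p φ t) :
    IsCentroidalEqualMass Ω ρ p φ t := by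
  have hmass := (hρ.forall_dualObjective_le_iff hΩ ht hp φ).1 hφ
  refine fun i => ⟨?_, hmass i⟩
  rw [hρ.barycenter_eq hΩ ht]
  simp only [hρ.cellMass_eq hΩ ht] at hmass
  exact (hρ.isHyperplaneNull_targetMeasure hΩ ht).eq_barycenter_of_isLocalMinOn hconv hp hpΩ
    hmin hmass i

/-- For nearby `q`, the chain `W(q) ≥ F(q, φ) > F(p, φ) = W(p)` passes the strict minimum from `F`
to the cost; no dependence of the maximizer on `q` is needed. -/
theorem strict_saddle_of_hessian_pos {φ : Dual N} (hc : IsCentroidalEqualMass Ω ρ p φ t)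
    (hpos : ∀ᶠ q in 𝓝 p, ∀ v : Config N d, v ≠ 0 →
      0 < fderiv ℝ (fderiv ℝ (fun r : Config N d => dualObjective Ω ρ r φ t)) q v v) :
    (∀ᶠ q in 𝓝[≠] p, dualObjective Ω ρ p φ t < dualObjective Ω ρ q φ t) ∧
      ∀ᶠ q in 𝓝[≠] p, transportCost Ω ρ p t < transportCost Ω ρ q t := by
  have hpair : Continuous fun q : Config N d => (q, φ) := by fun_prop
  have hinj : ∀ᶠ q in 𝓝 p, Function.Injective q :=
    (hpair.tendsto p).eventually (eventually_injective (z := (p, φ)) hp)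
  have hder : ∀ q : Config N d, Function.Injective q →
      HasFDerivAt (fun r : Config N d => dualObjective Ω ρ r φ t)
        ((kantorovichDeriv Ω (targetMeasure Ω ρ t) (q, φ)).comp
          (ContinuousLinearMap.inl ℝ (Config N d) (Dual N))) q := fun q hq => by
    have h1 : HasFDerivAt (fun r : Config N d => (r, φ))
        (ContinuousLinearMap.inl ℝ (Config N d) (Dual N)) q := hasFDerivAt_prodMk_left q φ
    have h2 := hρ.hasFDerivAt_dualObjective hΩ ht hq φ
    exact HasFDerivAt.comp (f := fun r : Config N d => (r, φ))
      (g := fun z : Config N d × Dual N => dualObjective Ω ρ z.1 z.2 t) q h2 h1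
  have h0 : fderiv ℝ (fun r : Config N d => dualObjective Ω ρ r φ t) p = 0 := by
    have h1 := (hρ.fderiv_dualObjective_eq_zero_iff hΩ ht hp φ).2 hc
    rw [(hρ.hasFDerivAt_dualObjective hΩ ht hp φ).fderiv] at h1
    rw [(hder p hp).fderiv, h1, ContinuousLinearMap.zero_comp]
  have hlt := eventually_lt_of_fderiv_fderiv_pos
    (hinj.mono fun q hq => (hder q hq).differentiableAt) h0 hpos
  refine ⟨hlt, ?_⟩
  filter_upwards [hlt, nhdsWithin_le_nhds hinj] with q hq hqinj
  rw [← ENNReal.toReal_lt_toReal (hρ.transportCost_ne_top hΩ ht hp)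
    (hρ.transportCost_ne_top hΩ ht hqinj), hρ.toReal_transportCost hΩ ht hp fun i => (hc i).2]
  exact hq.trans_le ((hρ.isGreatest_transportCost hΩ ht hqinj).2 ⟨φ, rfl⟩)

end SaddlePoint

end IsTargetDensity

/-! ### The coupled dynamics. -/

namespace IsCaratheodorySolution

variable {Kx Kφ : ℝ} {J : Set ℝ} {p : ℝ → Config N d} {φ : ℝ → Dual N}
  (h : IsCaratheodorySolution Ω ρ Kx Kφ J p φ) (hρ : IsTargetDensity Ω ρ) (hΩ : IsCompact Ω)
  (hJ : J.OrdConnected) (hJ0 : J ⊆ Ici 0) (hinj : ∀ t ∈ J, Function.Injective (p t))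
  (hpos : ∀ t ∈ J, ∀ i, 0 < cellMass Ω ρ (p t) (φ t) t i)
include h hρ hΩ hJ hJ0 hinj hpos

/-- Only the absolute continuity of `p` and `φ` enters, not the primal equation, so there is no
circularity with the term `ḃ`. -/
theorem ac_barycenter {s t : ℝ} (hs : s ∈ J) (ht : t ∈ J) :
    AbsolutelyContinuousOnInterval (fun r => barycenter Ω ρ (p r) (φ r) r) s t :=
  have hsub : uIcc s t ⊆ J := hJ.uIcc_subset hs ht
  hρ.absolutelyContinuousOnInterval_barycenter hΩ (z := fun r => (p r, φ r)) (hsub.trans hJ0)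
    ((h.ac_primal s hs t ht).prodMk (h.ac_dual s hs t ht))
    (fun r hr => hinj r (hsub hr)) fun r hr => hpos r (hsub hr)

/-- Ensures that `deriv` in the primal equation is a true derivative almost everywhere, not a
default zero. -/
theorem ae_differentiableAt_barycenter :
    ∀ᵐ t : ℝ, t ∈ J → ∀ i,
      DifferentiableAt ℝ (fun r => barycenter Ω ρ (p r) (φ r) r i) t := by
  filter_upwards [hJ.ae_differentiableAt fun s hs t ht =>
    h.ac_barycenter hρ hΩ hJ hJ0 hinj hpos hs ht] with t hdiff ht i
  exact differentiableAt_pi.1 (hdiff ht) i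

theorem ac_trackingError {s t : ℝ} (hs : s ∈ J) (ht : t ∈ J) :
    AbsolutelyContinuousOnInterval (trackingError Ω ρ p φ) s t :=
  AbsolutelyContinuousOnInterval.const_mul (1 / 2)
    (AbsolutelyContinuousOnInterval.finsetSum Finset.univ fun i _ =>
      (((h.ac_primal s hs t ht).eval i).sub
        ((h.ac_barycenter hρ hΩ hJ hJ0 hinj hpos hs ht).eval i)).norm_sq)

/-- The feedforward `ḃ` cancels, leaving `-Kx (p - b)` as the derivative of `p - b`. -/
theorem ae_hasDerivAt_trackingError :
    ∀ᵐ t : ℝ, t ∈ J →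
      HasDerivAt (trackingError Ω ρ p φ) (-2 * Kx * trackingError Ω ρ p φ t) t := by
  filter_upwards [h.primal, h.ae_differentiableAt_barycenter hρ hΩ hJ hJ0 hinj hpos]
    with t hprimal hdiff ht
  have h1 : ∀ i, HasDerivAt (fun r => ‖p r i - barycenter Ω ρ (p r) (φ r) r i‖ ^ 2)
      (-2 * Kx * ‖p t i - barycenter Ω ρ (p t) (φ t) t i‖ ^ 2) t := fun i => by
    have h2 := ((hprimal ht i).sub (hdiff ht i).hasDerivAt).norm_sq
    refine h2.congr_deriv ?_
    rw [add_sub_cancel_right]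
    simp only [Pi.sub_apply]
    rw [inner_neg_right, real_inner_smul_right, real_inner_self_eq_norm_sq]
    ring
  have h3 := (HasDerivAt.fun_sum fun i (_ : i ∈ Finset.univ) => h1 i).const_mul (1 / 2)
  refine h3.congr_deriv ?_
  rw [trackingError, ← Finset.mul_sum]
  ring

/-- The product with `exp (2 Kx r)` has zero derivative almost everywhere; being absolutely
continuous, it is constant. -/
theorem trackingError_eq {s t : ℝ} (hs : s ∈ J) (ht : t ∈ J) :
    trackingError Ω ρ p φ t
      = Real.exp (-2 * Kx * (t - s)) * trackingError Ω ρ p φ s := by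
  have hE : AbsolutelyContinuousOnInterval (fun r => Real.exp (2 * Kx * r)) s t :=
    ContDiffOn.absolutelyContinuousOnInterval (by fun_prop)
  have hac := hE.mul (h.ac_trackingError hρ hΩ hJ hJ0 hinj hpos hs ht)
  obtain ⟨C, hC⟩ := hac.const_of_ae_hasDerivAt_zero (by
    filter_upwards [h.ae_hasDerivAt_trackingError hρ hΩ hJ hJ0 hinj hpos] with r hr hrst
    have h1 : HasDerivAt (fun r => Real.exp (2 * Kx * r))
        (Real.exp (2 * Kx * r) * (2 * Kx)) r := by
      simpa using ((hasDerivAt_id r).const_mul (2 * Kx)).exp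
    refine (h1.mul (hr (hJ.uIcc_subset hs ht hrst))).congr_deriv ?_
    ring)
  have h1 := hC s left_mem_uIcc
  have h2 := hC t right_mem_uIcc
  simp only [Pi.mul_apply] at h1 h2
  have h3 : Real.exp (-2 * Kx * (t - s)) = Real.exp (2 * Kx * s) / Real.exp (2 * Kx * t) := by
    rw [← Real.exp_sub]; congr 1; ring
  rw [h3, div_mul_eq_mul_div, eq_div_iff (Real.exp_pos _).ne', h1, ← h2, mul_comm]

theorem tendsto_sub_barycenter (hKx : 0 < Kx) (hunb : ¬ BddAbove J) (i : Fin N) :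
    Tendsto (fun t => p t i - barycenter Ω ρ (p t) (φ t) t i) atTop (𝓝 0) := by
  obtain ⟨s, hs, -⟩ := not_bddAbove_iff.1 hunb 0
  have hmem : ∀ t, s ≤ t → t ∈ J := fun t hst => by
    obtain ⟨r, hr, htr⟩ := not_bddAbove_iff.1 hunb t
    exact hJ.out hs hr ⟨hst, htr.le⟩
  have hV : Tendsto (trackingError Ω ρ p φ) atTop (𝓝 0) := by
    have h1 : Tendsto (fun t => Real.exp (-2 * Kx * (t - s)) * trackingError Ω ρ p φ s) atTop
        (𝓝 (0 * trackingError Ω ρ p φ s)) := by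
      refine (Real.tendsto_exp_atBot.comp ?_).mul_const _
      exact (tendsto_atTop_add_const_right atTop (-s) tendsto_id).const_mul_atTop_of_neg
        (by linarith)
    rw [zero_mul] at h1
    refine h1.congr' ?_
    filter_upwards [eventually_ge_atTop s] with t hst
    exact (h.trackingError_eq hρ hΩ hJ hJ0 hinj hpos hs (hmem t hst)).symm
  have hsq : Tendsto (fun t => ‖p t i - barycenter Ω ρ (p t) (φ t) t i‖ ^ 2) atTop (𝓝 0) := by
    refine squeeze_zero (fun t => sq_nonneg _) (fun t => ?_) (by simpa using hV.const_mul 2)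
    have := Finset.single_le_sum
      (f := fun i => ‖p t i - barycenter Ω ρ (p t) (φ t) t i‖ ^ 2)
      (fun _ _ => sq_nonneg _) (Finset.mem_univ i)
    simp only [trackingError]
    linarith
  rw [tendsto_zero_iff_norm_tendsto_zero]
  simpa [Real.sqrt_sq (norm_nonneg _)] using hsq.sqrt

/-- The gradient is `a_i (p_i - b_i)` with `0 < a_i ≤ 1`, so the tracking error dominates it. -/
theorem tendsto_gradient (hKx : 0 < Kx) (hunb : ¬ BddAbove J) (i : Fin N) :
    Tendsto (fun t => gradient
      (fun y => dualObjective Ω ρ (Function.update (p t) i y) (φ t) t) (p t i)) atTop (𝓝 0) := by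
  have : Nonempty (Fin N) := ⟨i⟩
  obtain ⟨s, hs, -⟩ := not_bddAbove_iff.1 hunb 0
  have h1 := h.tendsto_sub_barycenter hρ hΩ hJ hJ0 hinj hpos hKx hunb i
  rw [tendsto_zero_iff_norm_tendsto_zero] at h1 ⊢
  refine squeeze_zero' (Eventually.of_forall fun t => norm_nonneg _) ?_ h1
  filter_upwards [eventually_ge_atTop s] with t hst
  obtain ⟨r, hr, htr⟩ := not_bddAbove_iff.1 hunb t
  have ht : t ∈ J := hJ.out hs hr ⟨hst, htr.le⟩
  rw [(hρ.hasGradientAt_dualObjective hΩ (hJ0 ht) (hinj t ht) (φ t) i).gradient, norm_smul,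
    Real.norm_of_nonneg (hpos t ht i).le]
  exact mul_le_of_le_one_left (norm_nonneg _) (hρ.cellMass_le_one hΩ (hJ0 ht) _ _ i)

end IsCaratheodorySolution

end SemiDiscreteOT

end

theorem theorem1 {d N : ℕ} (hN : 0 < N) (Ω : Set (Space d)) (hΩc : IsCompact Ω)
    (hΩ : Convex ℝ Ω) (ρ : Space d → ℝ → ℝ) (hρ : IsTargetDensity Ω ρ)
    (Kx Kφ : ℝ) (hKx : 0 < Kx) (hKφ : 0 < Kφ) :
    -- the instantaneous saddle-point problem, at any time and any configuration without overlaps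
    (∀ t : ℝ, 0 ≤ t → ∀ p : Config N d, Function.Injective p →
      -- the transport cost is finite and equals `max_φ F(p, φ, t)`
      (transportCost Ω ρ p t ≠ ⊤ ∧
        IsGreatest (range fun φ : Dual N => dualObjective Ω ρ p φ t)
          (transportCost Ω ρ p t).toReal) ∧
      -- `F` is `C¹` in `(p, φ)`, with partial gradients `a_i (p_i - b_i)` and `1/N - a_i`
      (∀ φ : Dual N,
        ContDiffAt ℝ 1 (fun z : Config N d × Dual N => dualObjective Ω ρ z.1 z.2 t) (p, φ) ∧
        (∀ i, HasGradientAt (fun y => dualObjective Ω ρ (Function.update p i y) φ t)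
          (cellMass Ω ρ p φ t i • (p i - barycenter Ω ρ p φ t i)) (p i)) ∧
        (∀ i, HasDerivAt (fun y => dualObjective Ω ρ p (Function.update φ i y) t)
          (1 / (N : ℝ) - cellMass Ω ρ p φ t i) (φ i))) ∧
      -- critical points: agents at the barycenters of cells of mass `1/N`
      (∀ φ : Dual N,
        fderiv ℝ (fun z : Config N d × Dual N => dualObjective Ω ρ z.1 z.2 t) (p, φ) = 0 ↔
          IsCentroidalEqualMass Ω ρ p φ t) ∧
      -- `F` is concave in `φ`, and its maximizers are the `φ` whose cells have mass `1/N`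
      ConcaveOn ℝ univ (fun φ : Dual N => dualObjective Ω ρ p φ t) ∧
      (∀ φ : Dual N, (∀ ψ : Dual N, dualObjective Ω ρ p ψ t ≤ dualObjective Ω ρ p φ t) ↔
        ∀ i, cellMass Ω ρ p φ t i = 1 / (N : ℝ)) ∧
      -- the dual law, at a frozen time and configuration, drives the masses to `1/N`
      (∀ ψ : ℝ → Dual N,
        (∀ s, 0 ≤ s → ∀ i, HasDerivWithinAt (fun r => ψ r i)
          (Kφ * (1 / (N : ℝ) - cellMass Ω ρ p (ψ s) t i)) (Ici 0) s) →
        (∀ i, Tendsto (fun s => cellMass Ω ρ p (ψ s) t i) atTop (𝓝 (1 / (N : ℝ)))) ∧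
        Tendsto (fun s => dualObjective Ω ρ p (ψ s) t) atTop
          (𝓝 (transportCost Ω ρ p t).toReal)) ∧
      -- local minimizers of the transport cost over `Ω^N` are critical
      ((∀ i, p i ∈ Ω) →
        IsLocalMinOn (fun q : Config N d => transportCost Ω ρ q t) {q | ∀ i, q i ∈ Ω} p →
        ∀ φ : Dual N, (∀ ψ : Dual N, dualObjective Ω ρ p ψ t ≤ dualObjective Ω ρ p φ t) →
          IsCentroidalEqualMass Ω ρ p φ t) ∧
      -- a critical point at which the Hessian in `p` is positive definite nearby is a strict local
      -- saddle point of `F`, and a strict local minimizer of the transport cost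
      (∀ φ : Dual N, IsCentroidalEqualMass Ω ρ p φ t →
        (∀ᶠ q in 𝓝 p, ∀ v : Config N d, v ≠ 0 →
          0 < fderiv ℝ (fderiv ℝ (fun r : Config N d => dualObjective Ω ρ r φ t)) q v v) →
        (∀ ψ : Dual N, dualObjective Ω ρ p ψ t ≤ dualObjective Ω ρ p φ t) ∧
        (∀ᶠ q in 𝓝[≠] p, dualObjective Ω ρ p φ t < dualObjective Ω ρ q φ t) ∧
        (∀ᶠ q in 𝓝[≠] p, transportCost Ω ρ p t < transportCost Ω ρ q t))) ∧
    -- the coupled dynamics, on any time interval `J` contained in `[0, ∞)`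
    (∀ J : Set ℝ, J.OrdConnected → J ⊆ Ici 0 →
      ∀ (p : ℝ → Config N d) (φ : ℝ → Dual N),
      IsCaratheodorySolution Ω ρ Kx Kφ J p φ →
      (∀ t ∈ J, Function.Injective (p t)) →
      (∀ t ∈ J, ∀ i, 0 < cellMass Ω ρ (p t) (φ t) t i) →
      -- the barycenters are absolutely continuous along the trajectory, so `ḃ` exists a.e.
      (∀ s ∈ J, ∀ t ∈ J,
        AbsolutelyContinuousOnInterval (fun r => barycenter Ω ρ (p r) (φ r) r) s t) ∧
      (∀ᵐ t : ℝ, t ∈ J → ∀ i,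
        DifferentiableAt ℝ (fun r => barycenter Ω ρ (p r) (φ r) r i) t) ∧
      -- the dual variables follow the gradient of `F` in `φ`
      (∀ᵐ t : ℝ, t ∈ J → ∀ i, HasDerivAt (fun s => φ s i)
        (Kφ * deriv (fun y => dualObjective Ω ρ (p t) (Function.update (φ t) i y) t) (φ t i)) t) ∧
      -- `V` is absolutely continuous, `V̇ = - 2 Kx V` a.e., and `V` decays exponentially
      (∀ s ∈ J, ∀ t ∈ J, AbsolutelyContinuousOnInterval (trackingError Ω ρ p φ) s t) ∧
      (∀ᵐ t : ℝ, t ∈ J →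
        HasDerivAt (trackingError Ω ρ p φ) (-2 * Kx * trackingError Ω ρ p φ t) t) ∧
      (∀ s ∈ J, ∀ t ∈ J, s ≤ t →
        trackingError Ω ρ p φ t = Real.exp (-2 * Kx * (t - s)) * trackingError Ω ρ p φ s) ∧
      -- on an unbounded time interval the agents converge to the moving barycenters, and the
      -- gradient of `F` in `p` vanishes asymptotically
      (¬ BddAbove J → ∀ i,
        Tendsto (fun t => p t i - barycenter Ω ρ (p t) (φ t) t i) atTop (𝓝 0) ∧
        Tendsto (fun t => gradient
          (fun y => dualObjective Ω ρ (Function.update (p t) i y) (φ t) t) (p t i))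
          atTop (𝓝 0))) := by
  have : Nonempty (Fin N) := Fin.pos_iff_nonempty.1 hN
  refine ⟨fun t ht p hp => ?_, fun J hJ hJ0 p φ h hinj hpos => ?_⟩
  · refine ⟨⟨hρ.transportCost_ne_top hΩc ht hp, hρ.isGreatest_transportCost hΩc ht hp⟩,
      fun φ => ⟨hρ.contDiffAt_dualObjective hΩc ht hp φ,
        hρ.hasGradientAt_dualObjective hΩc ht hp φ, hρ.hasDerivAt_dualObjective hΩc ht hp φ⟩,
      hρ.fderiv_dualObjective_eq_zero_iff hΩc ht hp, hρ.concaveOn_dualObjective hΩc ht hp,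
      hρ.forall_dualObjective_le_iff hΩc ht hp,
      fun ψ hψ => hρ.tendsto_of_dual_law hΩc ht hp hKφ hψ,
      fun hpΩ hmin φ hφ => hρ.isCentroidalEqualMass_of_isLocalMinOn hΩc ht hp hΩ hpΩ hmin hφ,
      fun φ hc hpos => ⟨?_, hρ.strict_saddle_of_hessian_pos hΩc ht hp hc hpos⟩⟩
    exact (hρ.forall_dualObjective_le_iff hΩc ht hp φ).2 fun i => (hc i).2
  · refine ⟨fun s hs t ht => h.ac_barycenter hρ hΩc hJ hJ0 hinj hpos hs ht,
      h.ae_differentiableAt_barycenter hρ hΩc hJ hJ0 hinj hpos, ?_,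
      fun s hs t ht => h.ac_trackingError hρ hΩc hJ hJ0 hinj hpos hs ht,
      h.ae_hasDerivAt_trackingError hρ hΩc hJ hJ0 hinj hpos,
      fun s hs t ht _ => h.trackingError_eq hρ hΩc hJ hJ0 hinj hpos hs ht,
      fun hunb i => ⟨h.tendsto_sub_barycenter hρ hΩc hJ hJ0 hinj hpos hKx hunb i,
        h.tendsto_gradient hρ hΩc hJ hJ0 hinj hpos hKx hunb i⟩⟩
    filter_upwards [h.dual] with t hdual ht i
    rw [(hρ.hasDerivAt_dualObjective hΩc (hJ0 ht) (hinj t ht) (φ t) i).deriv]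
    exact hdual ht i
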